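/- **System.** Fix a horizon $T$ and finite mode sets $\mathcal M^n=\{1,\dots,\kappa^n\}$, $n=0,1$. For $t=0,\dots,T$, $$X^0_{t+1}=A^{00}(M^0_t)X^0_t+B^{00}(M^0_t)U^0_t+W^0_t,$$ $$X^1_{t+1}=A^{10}(M^{0:1}_t)X^0_t+A^{11}(M^{0:1}_t)X^1_t+B^{10}(M^{0:1}_t)U^0_t+B^{11}(M^{0:1}_t)U^1_t+W^1_t,$$ with $X^n_t\in\mathbb R^{d_X^n}$, $U^n_t\in\mathbb R^{d_U^n}$, $M_t^n\in\mathcal M^n$. The random variables $X^n_0, W^n_t, M^n_t,\Gamma_t$ ($n=0,1$, $0\le t\le T$) are mutually independent; $X^n_0\sim\pi_{X^n_0}$ and $W^n_t\sim\pi_{W^n_t}$ have finite second moments, $W^n_t$ has zero mean, $M^n_t\sim\pi_{M^n}$, and $\Gamma_t\in\{0,1\}$ has a law $p$ that does not depend on $t$. The channel output is $(Z_t,\tilde Z_t)=(X^1_t,M^1_t)$ if $\Gamma_t=1$ and $(\emptyset,\emptyset)$ if $\Gamma_t=0$. The common information is $H^0_t=(X^0_{0:t},M^0_{0:t},Z_{0:t},\tilde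 Z_{0:t},U^0_{0:t-1})$, with set of realizations $\mathcal H^0_t$. The instantaneous cost is $c_t(x^{0:1},m^{0:1},u^{0:1})=x^\top Q_t(m^{0:1})x+u^\top R_t(m^{0:1})u$, where $x=(x^0,x^1)$, $u=(u^0,u^1)$, $Q_t(m^{0:1})$ is symmetric positive semidefinite and $R_t(m^{0:1})$ is symmetric positive definite. **Problem 2.** Let $\mathcal P$ be the set of measurable maps $\rho:\mathbb R^{d_X^1}\times\mathcal M^1\to\mathbb R^{d_U^1}$. A prescription strategy $\phi=(\phi_t)_{0\le t\le T}$ maps $h^0_t\in\mathcal H^0_t$ to a prescription $(u^0_t,\rho_t)\in\mathbb R^{d_U^0}\times\mathcal P$; the applied controls are $U^0_t=u^0_t$ and $U^1_t=\rho_t(X^1_t,M^1_t)$. It is feasible ($\phi\in\Phi^{prs}$) if $h^0_t\mapsto u^0_t$ and $(h^0_t,x^1,m^1)\mapsto\rho_t(x^1,m^1)$ are Borel measurable and all states and controls have finite second moments. Problem 2 is to minimize $\mathbb E^{\phi}\big[\sum_{t=0}^T c_t(X^{0:1}_t,M^{0:1}_t,U^{0:1}_t)\big]$ over $\phi\in\Phi^{prs}$.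 **Belief.** For $\tilde z\in\tilde{\mathcal M}^1=\mathcal M^1\cup\{\emptyset\}$ let $\omega^{\emptyset}=\pi_{M^1}$ and $\omega^{l}=\delta_l$ for $l\in\mathcal M^1$. Define $\psi_t(\theta,(u^0,\rho),x^0,m^0,\tilde z,z')$ to be $\delta_{x'}$ if $z'=x'\in\mathbb R^{d_X^1}$. If $z'=\emptyset$, it is the law of $$A^{10}(m^0,M)x^0+A^{11}(m^0,M)X+B^{10}(m^0,M)u^0+B^{11}(m^0,M)\rho(X,M)+W,$$ where $X\sim\theta$, $M\sim\omega^{\tilde z}$, $W\sim\pi_{W^1_t}$ are independent. Under $\phi$, the belief $\theta_t=\theta_t(h^0_t)$ is given by $\theta_0=\pi_{X_0^1}$ if $z_0=\emptyset$, $\theta_0=\delta_{x_0^1}$ if $z_0=x^1_0$, and $\theta_{t+1}=\psi_t(\theta_t,\phi_t(h^0_t),x^0_t,m^0_t,\tilde z_t,z_{t+1})$. **Theorem.** Let $\Delta(\mathbb R^{d_X^1})$ be the set of probability measures on $\mathbb R^{d_X^1}$ with finite second moment. Suppose there are functions $V_t:\mathbb R^{d_X^0}\times\mathcal M^0\times\Delta(\mathbb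 R^{d_X^1})\times\tilde{\mathcal M}^1\to\mathbb R$, $t=0,\dots,T+1$, with $V_{T+1}=0$ such that for all $t=0,\dots,T$ and all $(x^0,m^0,\theta,\tilde z)$ $$V_t(x^0,m^0,\theta,\tilde z)=\min_{u^0\in\mathbb R^{d_U^0},\ \rho\in\mathcal P}\mathbb E\Big[c_t\big(x^0,X,m^0,M,u^0,\rho(X,M)\big)+V_{t+1}\big(X^{0\prime},M^{0\prime},\psi_t(\theta,(u^0,\rho),x^0,m^0,\tilde z,Z'),\tilde Z'\big)\Big].$$ Here $X\sim\theta$, $M\sim\omega^{\tilde z}$, $W^n\sim\pi_{W_t^n}$, $M^{n\prime}\sim\pi_{M^n}$, $\Gamma'\sim p$ are independent, $X^{0\prime},X^{1\prime}$ are the next states from $(x^0,X)$ with modes $(m^0,M)$, controls $(u^0,\rho(X,M))$ and noises $W^0,W^1$, and $(Z',\tilde Z')=(X^{1\prime},M^{1\prime})$ if $\Gamma'=1$ and $(\emptyset,\emptyset)$ if $\Gamma'=0$. The expectation takes values in $[-\infty,+\infty]$, and $V_{t+1}$ is read as $+\infty$ at a measure outside $\Delta(\mathbb R^{d_X^1})$.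 Suppose further that some $\phi^*\in\Phi^{prs}$ is such that, for all $t\le T$ and all $h^0_t\in\mathcal H^0_t$ with belief $\theta_t$ under $\phi^*$, the prescription $\phi^*_t(h^0_t)$ attains the minimum defining $V_t(x^0_t,m^0_t,\theta_t,\tilde z_t)$. Then $\phi^*$ is optimal for Problem 2. Moreover, for every $\phi\in\Phi^{prs}$, every $t\le T$ and every Borel set $E\subseteq\mathbb R^{d_X^1}$, $\theta_t(H^0_t)(E)=\mathbb P^{\phi}(X^1_t\in E\mid H^0_t)$ almost surely, so that this conditional law evolves by the update $\psi_t$, which does not depend on the strategy. -/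

import Mathlib

open MeasureTheory ProbabilityTheory
open scoped Matrix ENNReal

namespace NCS

noncomputable section

/-- The disjoint-union σ-algebra on `Option α`: a set is measurable iff its trace on `α` is. -/
instance instMeasurableSpaceOption {α : Type*} [m : MeasurableSpace α] :
    MeasurableSpace (Option α) :=
  MeasurableSpace.map some m

/-- The data of the two-plant switched linear system: horizon, dimensions, numbers of modes, system
matrices, cost matrices and the laws of the primitive random variables. Sequences are indexed by
`ℕ`; only the times `0, …, T` matter. A vector of `ℝ^d` is a function `Fin d → ℝ`. -/
structure SwitchedSystem where
  T : ℕ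
  dX0 : ℕ
  dX1 : ℕ
  dU0 : ℕ
  dU1 : ℕ
  κ0 : ℕ
  κ1 : ℕ
  A00 : Fin κ0 → Matrix (Fin dX0) (Fin dX0) ℝ
  A10 : Fin κ0 → Fin κ1 → Matrix (Fin dX1) (Fin dX0) ℝ
  A11 : Fin κ0 → Fin κ1 → Matrix (Fin dX1) (Fin dX1) ℝ
  B00 : Fin κ0 → Matrix (Fin dX0) (Fin dU0) ℝ
  B10 : Fin κ0 → Fin κ1 → Matrix (Fin dX1) (Fin dU0) ℝ
  B11 : Fin κ0 → Fin κ1 → Matrix (Fin dX1) (Fin dU1) ℝ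
  Q : ℕ → Fin κ0 → Fin κ1 → Matrix (Fin dX0 ⊕ Fin dX1) (Fin dX0 ⊕ Fin dX1) ℝ
  R : ℕ → Fin κ0 → Fin κ1 → Matrix (Fin dU0 ⊕ Fin dU1) (Fin dU0 ⊕ Fin dU1) ℝ
  Q_posSemidef : ∀ t ≤ T, ∀ m0 m1, (Q t m0 m1).PosSemidef
  R_posDef : ∀ t ≤ T, ∀ m0 m1, (R t m0 m1).PosDef
  /-- laws of the initial states -/
  lawX0 : ProbabilityMeasure (Fin dX0 → ℝ)
  lawX1 : ProbabilityMeasure (Fin dX1 → ℝ)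
  /-- laws of the noises at each time -/
  lawW0 : ℕ → ProbabilityMeasure (Fin dX0 → ℝ)
  lawW1 : ℕ → ProbabilityMeasure (Fin dX1 → ℝ)
  /-- laws of the modes, the same at all times -/
  lawM0 : ProbabilityMeasure (Fin κ0)
  lawM1 : ProbabilityMeasure (Fin κ1)
  /-- law of the link state, the same at all times; `true` is a successful transmission -/
  lawΓ : ProbabilityMeasure Bool
  lawX0_memLp : MemLp id 2 (lawX0 : Measure (Fin dX0 → ℝ))
  lawX1_memLp : MemLp id 2 (lawX1 : Measure (Fin dX1 → ℝ))
  lawW0_memLp : ∀ t ≤ T, MemLp id 2 (lawW0 t : Measure (Fin dX0 → ℝ))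
  lawW1_memLp : ∀ t ≤ T, MemLp id 2 (lawW1 t : Measure (Fin dX1 → ℝ))
  lawW0_mean : ∀ t ≤ T, ∫ w, w ∂(lawW0 t : Measure (Fin dX0 → ℝ)) = 0
  lawW1_mean : ∀ t ≤ T, ∫ w, w ∂(lawW1 t : Measure (Fin dX1 → ℝ)) = 0

namespace SwitchedSystem

/-- Global states. -/
abbrev X0 (S : SwitchedSystem) : Type := Fin S.dX0 → ℝ
/-- Local states. -/
abbrev X1 (S : SwitchedSystem) : Type := Fin S.dX1 → ℝ
/-- Actions of the global controller. -/
abbrev U0 (S : SwitchedSystem) : Type := Fin S.dU0 → ℝ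
/-- Actions of the local controller. -/
abbrev U1 (S : SwitchedSystem) : Type := Fin S.dU1 → ℝ
/-- Global modes. -/
abbrev M0 (S : SwitchedSystem) : Type := Fin S.κ0
/-- Local modes. -/
abbrev M1 (S : SwitchedSystem) : Type := Fin S.κ1

variable (S : SwitchedSystem)

/-- Next global state. -/
def next0 (m0 : S.M0) (x0 : S.X0) (u0 : S.U0) (w0 : S.X0) : S.X0 :=
  S.A00 m0 *ᵥ x0 + S.B00 m0 *ᵥ u0 + w0

/-- Next local state. -/
def next1 (m0 : S.M0) (m1 : S.M1) (x0 : S.X0) (x1 : S.X1) (u0 : S.U0) (u1 : S.U1) (w1 : S.X1) :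
    S.X1 :=
  S.A10 m0 m1 *ᵥ x0 + S.A11 m0 m1 *ᵥ x1 + S.B10 m0 m1 *ᵥ u0 + S.B11 m0 m1 *ᵥ u1 + w1

/-- Instantaneous quadratic cost. -/
def cost (t : ℕ) (x0 : S.X0) (x1 : S.X1) (m0 : S.M0) (m1 : S.M1) (u0 : S.U0) (u1 : S.U1) : ℝ :=
  Sum.elim x0 x1 ⬝ᵥ (S.Q t m0 m1 *ᵥ Sum.elim x0 x1) +
    Sum.elim u0 u1 ⬝ᵥ (S.R t m0 m1 *ᵥ Sum.elim u0 u1)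

/-- Channel output: the pair `(Z, Z̃)` is `some (x1, m1)` on success and `none`, standing for
`(∅, ∅)`, on failure. -/
def channel (γ : Bool) (x1 : S.X1) (m1 : S.M1) : Option (S.X1 × S.M1) :=
  if γ then some (x1, m1) else none

/-- What becomes commonly known at one time: global state, global mode, channel output. -/
abbrev Obs : Type := S.X0 × S.M0 × Option (S.X1 × S.M1)

/-- Realizations of the common information at time `t`: the observations at times `0, …, t` and
the actions of the global controller at times `0, …, t - 1`. -/
abbrev Hist (t : ℕ) : Type := (Fin (t + 1) → S.Obs) × (Fin t → S.U0)

variable {S}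

namespace Hist

/-- Current global state. -/
def x0 {t : ℕ} (h : S.Hist t) : S.X0 := (h.1 (Fin.last t)).1
/-- Current global mode. -/
def m0 {t : ℕ} (h : S.Hist t) : S.M0 := (h.1 (Fin.last t)).2.1
/-- Current channel output for the local state. -/
def z {t : ℕ} (h : S.Hist t) : Option S.X1 := (h.1 (Fin.last t)).2.2.map Prod.fst
/-- Current channel output for the local mode. -/
def zt {t : ℕ} (h : S.Hist t) : Option S.M1 := (h.1 (Fin.last t)).2.2.map Prod.snd
/-- The common information one step earlier. -/
def past {t : ℕ} (h : S.Hist (t + 1)) : S.Hist t := (Fin.init h.1, Fin.init h.2)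
/-- The initial common information. -/
def start (o : S.Obs) : S.Hist 0 := (fun _ => o, Fin.elim0)
/-- Common information extended by the last global action and a new observation. -/
def extend {t : ℕ} (h : S.Hist t) (u0 : S.U0) (o : S.Obs) : S.Hist (t + 1) :=
  (Fin.snoc (α := fun _ => S.Obs) h.1 o, Fin.snoc (α := fun _ => S.U0) h.2 u0)

end Hist

variable (S)

/-- A prescription strategy: at each time the common information is mapped to an action of the
global controller and a prescription for the local controller. -/
structure Strategy where
  act : (t : ℕ) → S.Hist t → S.U0
  prs : (t : ℕ) → S.Hist t → S.X1 × S.M1 → S.U1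

/-- Index set of the primitive random variables. -/
inductive PrimIdx (T : ℕ) : Type
  | x0 : PrimIdx T
  | x1 : PrimIdx T
  | w0 (t : Fin (T + 1)) : PrimIdx T
  | w1 (t : Fin (T + 1)) : PrimIdx T
  | m0 (t : Fin (T + 1)) : PrimIdx T
  | m1 (t : Fin (T + 1)) : PrimIdx T
  | γ (t : Fin (T + 1)) : PrimIdx T

/-- The primitive random variables of the system on a probability space, with the prescribed laws
and mutually independent. -/
structure Noise {Ω : Type*} [MeasurableSpace Ω] (P : Measure Ω) where
  X0 : Ω → S.X0
  X1 : Ω → S.X1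
  W0 : ℕ → Ω → S.X0
  W1 : ℕ → Ω → S.X1
  M0 : ℕ → Ω → S.M0
  M1 : ℕ → Ω → S.M1
  Γ : ℕ → Ω → Bool
  hasLaw_X0 : HasLaw X0 S.lawX0 P
  hasLaw_X1 : HasLaw X1 S.lawX1 P
  hasLaw_W0 : ∀ t ≤ S.T, HasLaw (W0 t) (S.lawW0 t) P
  hasLaw_W1 : ∀ t ≤ S.T, HasLaw (W1 t) (S.lawW1 t) P
  hasLaw_M0 : ∀ t ≤ S.T, HasLaw (M0 t) S.lawM0 P
  hasLaw_M1 : ∀ t ≤ S.T, HasLaw (M1 t) S.lawM1 P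
  hasLaw_Γ : ∀ t ≤ S.T, HasLaw (Γ t) S.lawΓ P
  measurable_X0 : Measurable X0
  measurable_X1 : Measurable X1
  measurable_W0 : ∀ t ≤ S.T, Measurable (W0 t)
  measurable_W1 : ∀ t ≤ S.T, Measurable (W1 t)
  measurable_M0 : ∀ t ≤ S.T, Measurable (M0 t)
  measurable_M1 : ∀ t ≤ S.T, Measurable (M1 t)
  measurable_Γ : ∀ t ≤ S.T, Measurable (Γ t)
  /-- the σ-algebras generated by the primitive random variables are mutually independent -/
  indep : iIndep (fun i : PrimIdx S.T =>
    match i with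
    | .x0 => MeasurableSpace.comap X0 inferInstance
    | .x1 => MeasurableSpace.comap X1 inferInstance
    | .w0 t => MeasurableSpace.comap (W0 t) inferInstance
    | .w1 t => MeasurableSpace.comap (W1 t) inferInstance
    | .m0 t => MeasurableSpace.comap (M0 t) inferInstance
    | .m1 t => MeasurableSpace.comap (M1 t) inferInstance
    | .γ t => MeasurableSpace.comap (Γ t) inferInstance) P

variable {S}

section ClosedLoop

variable {Ω : Type*} [MeasurableSpace Ω] {P : Measure Ω} (N : S.Noise P) (φ : S.Strategy)

/-- The closed loop under `φ`: common information and local state at time `t`. -/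
def traj : (t : ℕ) → Ω → S.Hist t × S.X1
  | 0, ω => (Hist.start (N.X0 ω, N.M0 0 ω, S.channel (N.Γ 0 ω) (N.X1 ω) (N.M1 0 ω)), N.X1 ω)
  | t + 1, ω =>
    let h : S.Hist t := (traj t ω).1
    let x1 : S.X1 := (traj t ω).2
    let u0 : S.U0 := φ.act t h
    let u1 : S.U1 := φ.prs t h (x1, N.M1 t ω)
    let y0 : S.X0 := S.next0 (N.M0 t ω) h.x0 u0 (N.W0 t ω)
    let y1 : S.X1 := S.next1 (N.M0 t ω) (N.M1 t ω) h.x0 x1 u0 u1 (N.W1 t ω)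
    (h.extend u0 (y0, N.M0 (t + 1) ω, S.channel (N.Γ (t + 1) ω) y1 (N.M1 (t + 1) ω)), y1)

/-- Common information at time `t`. -/
def hist (t : ℕ) (ω : Ω) : S.Hist t := (traj N φ t ω).1
/-- Global state at time `t`. -/
def state0 (t : ℕ) (ω : Ω) : S.X0 := (hist N φ t ω).x0
/-- Local state at time `t`. -/
def state1 (t : ℕ) (ω : Ω) : S.X1 := (traj N φ t ω).2
/-- Action of the global controller at time `t`. -/
def ctrl0 (t : ℕ) (ω : Ω) : S.U0 := φ.act t (hist N φ t ω)
/-- Action of the local controller at time `t`. -/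
def ctrl1 (t : ℕ) (ω : Ω) : S.U1 := φ.prs t (hist N φ t ω) (state1 N φ t ω, N.M1 t ω)

/-- Feasible prescription strategies: Borel measurable, with all states and control actions of
finite second moment. -/
structure Feasible : Prop where
  measurable_act : ∀ t ≤ S.T, Measurable (φ.act t)
  measurable_prs : ∀ t ≤ S.T,
    Measurable (fun p : S.Hist t × (S.X1 × S.M1) => φ.prs t p.1 p.2)
  state0_memLp : ∀ t ≤ S.T, MemLp (state0 N φ t) 2 P
  state1_memLp : ∀ t ≤ S.T, MemLp (state1 N φ t) 2 P
  ctrl0_memLp : ∀ t ≤ S.T, MemLp (ctrl0 N φ t) 2 P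
  ctrl1_memLp : ∀ t ≤ S.T, MemLp (ctrl1 N φ t) 2 P

/-- Total expected cost of a prescription strategy. -/
def totalCost : ℝ :=
  ∫ ω, ∑ t ∈ Finset.range (S.T + 1),
    S.cost t (state0 N φ t ω) (state1 N φ t ω) (N.M0 t ω) (N.M1 t ω)
      (ctrl0 N φ t ω) (ctrl1 N φ t ω) ∂P

/-- Optimality for the centralized problem: feasible, and of least total expected cost among all
feasible prescription strategies. -/
def IsOptimal : Prop :=
  Feasible N φ ∧ ∀ φ' : S.Strategy, Feasible N φ' → totalCost N φ ≤ totalCost N φ'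

end ClosedLoop

variable (S)

/-- Law of the local mode given the observed local mode. -/
def modeLaw : Option S.M1 → Measure S.M1
  | none => S.lawM1
  | some m => Measure.dirac m

/-- The belief update `ψ_t(θ, (u0, ρ), x0, m0, z̃, z')`, with `z'` the next channel output for the
local state. -/
def update (t : ℕ) (θ : Measure S.X1) (u0 : S.U0) (ρ : S.X1 × S.M1 → S.U1) (x0 : S.X0) (m0 : S.M0)
    (zt : Option S.M1) : Option S.X1 → Measure S.X1
  | some y => Measure.dirac y
  | none => (θ.prod ((S.modeLaw zt).prod (S.lawW1 t : Measure S.X1))).map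
      (fun p : S.X1 × S.M1 × S.X1 => S.next1 m0 p.2.1 x0 p.1 u0 (ρ (p.1, p.2.1)) p.2.2)

variable {S}

/-- The common belief on the local state at time `t` under `φ`, as a function of the realization of
the common information. -/
def belief (φ : S.Strategy) : (t : ℕ) → S.Hist t → Measure S.X1
  | 0, h => match h.z with
    | some y => Measure.dirac y
    | none => S.lawX1
  | t + 1, h => S.update t (belief φ t h.past) (φ.act t h.past) (φ.prs t h.past)
      h.past.x0 h.past.m0 h.past.zt h.z

variable (S)

/-- Probability measures on the local state space with finite second moment. -/
def Belief : Type :=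
  {θ : Measure S.X1 // IsProbabilityMeasure θ ∧ MemLp id 2 θ}

/-- Value functions: one for each time, of global state, global mode, belief and observed local
mode. -/
abbrev ValueFn : Type := ℕ → S.X0 → S.M0 → S.Belief → Option S.M1 → ℝ

variable {S}

open Classical in
/-- A function of beliefs, extended by `+∞` to measures that are not beliefs. (A prescription for
which the updated measure has infinite second moment also has infinite expected instantaneous cost,
as the matrix `R` is positive definite.) -/
def extendTop (v : S.Belief → ℝ) (θ : Measure S.X1) : EReal :=
  if h : IsProbabilityMeasure θ ∧ MemLp id 2 θ then ((v ⟨θ, h⟩ : ℝ) : EReal) else ⊤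

/-- Expectation of an extended-real function: integral of the positive part minus integral of the
negative part. -/
def eexpect {α : Type*} [MeasurableSpace α] (μ : Measure α) (f : α → EReal) : EReal :=
  ((∫⁻ a, (f a).toENNReal ∂μ : ℝ≥0∞) : EReal) - ((∫⁻ a, (-f a).toENNReal ∂μ : ℝ≥0∞) : EReal)

variable (S)

/-- The joint law, for belief `θ` and observed local mode `zt`, of
`(X¹_t, M¹_t, W⁰_t, W¹_t, M⁰_{t+1}, M¹_{t+1}, Γ_{t+1})`. -/
def stepLaw (t : ℕ) (θ : Measure S.X1) (zt : Option S.M1) :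
    Measure (S.X1 × S.M1 × S.X0 × S.X1 × S.M0 × S.M1 × Bool) :=
  θ.prod ((S.modeLaw zt).prod ((S.lawW0 t : Measure S.X0).prod ((S.lawW1 t : Measure S.X1).prod
    ((S.lawM0 : Measure S.M0).prod ((S.lawM1 : Measure S.M1).prod (S.lawΓ : Measure Bool))))))

/-- The quantity minimized in the dynamic program at time `t`: expected instantaneous cost plus
value at the next time, for the prescription `(u0, ρ)`. -/
def dpObjective (V : S.ValueFn) (t : ℕ) (x0 : S.X0) (m0 : S.M0) (θ : S.Belief) (zt : Option S.M1)
    (u0 : S.U0) (ρ : S.X1 × S.M1 → S.U1) : EReal :=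
  eexpect (S.stepLaw t θ.1 zt) fun (x1, m1, w0, w1, m0', m1', γ') =>
    let u1 : S.U1 := ρ (x1, m1)
    let y0 : S.X0 := S.next0 m0 x0 u0 w0
    let y1 : S.X1 := S.next1 m0 m1 x0 x1 u0 u1 w1
    let o : Option (S.X1 × S.M1) := S.channel γ' y1 m1'
    ((S.cost t x0 x1 m0 m1 u0 u1 : ℝ) : EReal) +
      extendTop (fun θ' => V (t + 1) y0 m0' θ' (o.map Prod.snd))
        (S.update t θ.1 u0 ρ x0 m0 zt (o.map Prod.fst))

/-- `V` satisfies the backward dynamic program; each minimum is over all actions of the global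
controller and all measurable prescriptions, and is attained. -/
structure SolvesDP (V : S.ValueFn) : Prop where
  terminal : ∀ x0 m0 θ zt, V (S.T + 1) x0 m0 θ zt = 0
  step : ∀ t ≤ S.T, ∀ x0 m0 θ zt,
    IsLeast {q : EReal | ∃ (u0 : S.U0) (ρ : S.X1 × S.M1 → S.U1), Measurable ρ ∧
      q = S.dpObjective V t x0 m0 θ zt u0 ρ} ((V t x0 m0 θ zt : ℝ) : EReal)

/-- At every time and for every realization of the common information, with its belief under `φ`,
the prescription chosen by `φ` attains the minimum that defines `V`. -/
def AttainsDP (V : S.ValueFn) (φ : S.Strategy) : Prop :=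
  ∀ t ≤ S.T, ∀ (h : S.Hist t) (θ : S.Belief), θ.1 = belief φ t h →
    S.dpObjective V t h.x0 h.m0 θ h.zt (φ.act t h) (φ.prs t h) =
      ((V t h.x0 h.m0 θ h.zt : ℝ) : EReal)

end SwitchedSystem

end

end NCS

namespace NCS

noncomputable section

/-! ### Measurability on `Option` with the disjoint-union σ-algebra. -/

section Option

variable {α β γ : Type*} [MeasurableSpace α] [MeasurableSpace β] [MeasurableSpace γ]

/-! The theorem is a verification argument for a dynamic program on the common-information belief.
It has a probabilistic half and a control half.

The probabilistic half is `lintegral_belief`: the joint law of common information, local state and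
local mode disintegrates over the common information as belief times mode law. It is proved by
induction on time. The innovation (noises at `t`, modes and link at `t + 1`) is independent of
everything up to `t` (`lintegral_innovation`), so a closed-loop step is an integral against
`stepLaw`. Within a step, the next global state and mode carry no further information on the next
local state, because they are driven by a separate noise and a fresh mode
(`lintegral_stepLaw_next`). The channel output either reveals local state and mode exactly, leaving
Dirac masses, or is a failure, independent of both, leaving the predicted law times the prior mode
law (`lintegral_channel`). Testing the disintegration on products of indicators gives the
conditional-law claim.

For the control half, `costToGo` is defined on every history by iterating `stepLaw`, and the tower
property identifies its mean at time 0 with the total cost (`ofReal_totalCost`). Backward induction,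
history by history, gives `V ≤ costToGo` for every measurable strategy and the reverse for a
minimizing one (`SolvesDP.le_costToGo`, `SolvesDP.costToGo_le`). The initial history and belief do
not depend on the strategy, so the two bounds meet at time 0.

Costs are nonnegative, hence so is `V`, and all comparisons take place in `ℝ≥0∞`. They use only
monotonicity of the integral, so `V` need not be measurable. The value `+∞` outside the set of
beliefs is harmless: since `R` is positive definite, a prescription with finite expected stage cost
keeps the second moment finite (`memLp_update`), and one with infinite stage cost satisfies the
lower bound trivially. -/

theorem measurable_some : Measurable (some : α → Option α) := fun _ hs => hs

theorem measurable_of_some {f : Option α → β} (hf : Measurable fun a => f (some a)) :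
    Measurable f := fun _ hs => hf hs

theorem measurable_option_map {f : α → β} (hf : Measurable f) :
    Measurable (Option.map f) :=
  measurable_of_some (measurable_some.comp hf)

theorem measurableEmbedding_some : MeasurableEmbedding (some : α → Option α) where
  injective := Option.some_injective α
  measurable := measurable_some
  measurableSet_image' s hs := by
    change MeasurableSet (some ⁻¹' (some '' s))
    rwa [Set.preimage_image_eq _ (Option.some_injective α)]

theorem measurableSet_singleton_none : MeasurableSet ({none} : Set (Option α)) := by
  change MeasurableSet (some ⁻¹' {none})
  convert MeasurableSet.empty
  ext
  simp

/-- The product σ-algebra is not itself a pushforward, so the preimage is cut into the image of a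
measurable set under the embedding `some × id` and a strip over `none`. -/
theorem measurable_prod_of_option {f : Option α → β → γ}
    (hs : Measurable fun p : α × β => f (some p.1) p.2) (hn : Measurable (f none)) :
    Measurable fun p : Option α × β => f p.1 p.2 := by
  intro s hs'
  have h : (fun p : Option α × β => f p.1 p.2) ⁻¹' s =
      Prod.map some id '' ((fun p : α × β => f (some p.1) p.2) ⁻¹' s) ∪
        {none} ×ˢ (f none ⁻¹' s) := by
    ext ⟨o, b⟩
    cases o <;> simp
  rw [h]
  exact ((measurableEmbedding_some.prodMap MeasurableEmbedding.id).measurableSet_image.2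
    (hs hs')).union (measurableSet_singleton_none.prod (hn hs'))

end Option

/-! ### Measurability of the dynamics, the cost and the histories. -/

namespace SwitchedSystem

variable {S : SwitchedSystem} {α : Type*} [mα : MeasurableSpace α]

theorem measurable_mulVec {ι m n : Type*} [Finite ι] [MeasurableSpace ι]
    [MeasurableSingletonClass ι] [Fintype n] (A : ι → Matrix m n ℝ) {i : α → ι} {v : α → n → ℝ}
    (hi : Measurable i) (hv : Measurable v) : Measurable fun a => A (i a) *ᵥ v a := by
  refine measurable_pi_iff.2 fun k => ?_
  simp only [Matrix.mulVec, dotProduct]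
  refine Finset.measurable_sum _ fun j _ => ?_
  exact ((measurable_of_finite fun q => A q k j).comp hi).mul ((measurable_pi_apply j).comp hv)

theorem measurable_dotProduct {n : Type*} [Fintype n] {u v : α → n → ℝ}
    (hu : Measurable u) (hv : Measurable v) : Measurable fun a => u a ⬝ᵥ v a := by
  simp only [dotProduct]
  exact Finset.measurable_sum _ fun j _ =>
    ((measurable_pi_apply j).comp hu).mul ((measurable_pi_apply j).comp hv)

theorem measurable_sumElim {m n : Type*} {u : α → m → ℝ} {v : α → n → ℝ}
    (hu : Measurable u) (hv : Measurable v) : Measurable fun a => Sum.elim (u a) (v a) := by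
  refine measurable_pi_iff.2 fun k => ?_
  cases k with
  | inl i => exact (measurable_pi_apply i).comp hu
  | inr i => exact (measurable_pi_apply i).comp hv

@[fun_prop]
theorem measurable_next0 {m0 : α → S.M0} {x0 : α → S.X0} {u0 : α → S.U0} {w0 : α → S.X0}
    (hm : Measurable m0) (hx : Measurable x0) (hu : Measurable u0) (hw : Measurable w0) :
    Measurable fun a => S.next0 (m0 a) (x0 a) (u0 a) (w0 a) :=
  ((measurable_mulVec S.A00 hm hx).add (measurable_mulVec S.B00 hm hu)).add hw

@[fun_prop]
theorem measurable_next1 {m0 : α → S.M0} {m1 : α → S.M1} {x0 : α → S.X0} {x1 : α → S.X1}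
    {u0 : α → S.U0} {u1 : α → S.U1} {w1 : α → S.X1} (hm0 : Measurable m0) (hm1 : Measurable m1)
    (hx0 : Measurable x0) (hx1 : Measurable x1) (hu0 : Measurable u0) (hu1 : Measurable u1)
    (hw1 : Measurable w1) :
    Measurable fun a => S.next1 (m0 a) (m1 a) (x0 a) (x1 a) (u0 a) (u1 a) (w1 a) :=
  ((((measurable_mulVec (fun q : S.M0 × S.M1 => S.A10 q.1 q.2) (hm0.prodMk hm1) hx0).add
    (measurable_mulVec (fun q : S.M0 × S.M1 => S.A11 q.1 q.2) (hm0.prodMk hm1) hx1)).add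
    (measurable_mulVec (fun q : S.M0 × S.M1 => S.B10 q.1 q.2) (hm0.prodMk hm1) hu0)).add
    (measurable_mulVec (fun q : S.M0 × S.M1 => S.B11 q.1 q.2) (hm0.prodMk hm1) hu1)).add hw1

@[fun_prop]
theorem measurable_cost (t : ℕ) {x0 : α → S.X0} {x1 : α → S.X1} {m0 : α → S.M0} {m1 : α → S.M1}
    {u0 : α → S.U0} {u1 : α → S.U1} (hx0 : Measurable x0) (hx1 : Measurable x1)
    (hm0 : Measurable m0) (hm1 : Measurable m1) (hu0 : Measurable u0) (hu1 : Measurable u1) :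
    Measurable fun a => S.cost t (x0 a) (x1 a) (m0 a) (m1 a) (u0 a) (u1 a) := by
  have hx := measurable_sumElim hx0 hx1
  have hu := measurable_sumElim hu0 hu1
  exact (measurable_dotProduct hx (measurable_mulVec (fun q : S.M0 × S.M1 => S.Q t q.1 q.2)
    (hm0.prodMk hm1) hx)).add (measurable_dotProduct hu
      (measurable_mulVec (fun q : S.M0 × S.M1 => S.R t q.1 q.2) (hm0.prodMk hm1) hu))

@[fun_prop]
theorem measurable_channel {γ : α → Bool} {x1 : α → S.X1} {m1 : α → S.M1} (hγ : Measurable γ)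
    (hx : Measurable x1) (hm : Measurable m1) :
    Measurable fun a => S.channel (γ a) (x1 a) (m1 a) :=
  Measurable.ite (hγ (measurableSet_singleton true)) (measurable_some.comp (hx.prodMk hm))
    measurable_const

namespace Hist

variable {t : ℕ}

@[fun_prop]
theorem measurable_x0 : Measurable (Hist.x0 : S.Hist t → S.X0) := by
  unfold Hist.x0; fun_prop

@[fun_prop]
theorem measurable_m0 : Measurable (Hist.m0 : S.Hist t → S.M0) := by
  unfold Hist.m0; fun_prop

@[fun_prop]
theorem measurable_z : Measurable (Hist.z : S.Hist t → Option S.X1) :=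
  (measurable_option_map measurable_fst).comp
    (by fun_prop : Measurable fun h : S.Hist t => (h.1 (Fin.last t)).2.2)

@[fun_prop]
theorem measurable_zt : Measurable (Hist.zt : S.Hist t → Option S.M1) :=
  (measurable_option_map measurable_snd).comp
    (by fun_prop : Measurable fun h : S.Hist t => (h.1 (Fin.last t)).2.2)

@[fun_prop]
theorem measurable_past : Measurable (Hist.past : S.Hist (t + 1) → S.Hist t) := by
  unfold Hist.past Fin.init; fun_prop

@[fun_prop]
theorem measurable_start : Measurable (Hist.start : S.Obs → S.Hist 0) := by
  unfold Hist.start; fun_prop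

theorem measurable_snoc {β : Type*} [MeasurableSpace β] {n : ℕ} {f : α → Fin n → β} {g : α → β}
    (hf : Measurable f) (hg : Measurable g) :
    Measurable fun a => Fin.snoc (α := fun _ => β) (f a) (g a) := by
  refine measurable_pi_iff.2 fun i => ?_
  induction i using Fin.lastCases with
  | last => simpa using hg
  | cast i => simpa using measurable_pi_iff.1 hf i

@[fun_prop]
theorem measurable_extend {h : α → S.Hist t} {u0 : α → S.U0} {o : α → S.Obs}
    (hh : Measurable h) (hu : Measurable u0) (ho : Measurable o) :
    Measurable fun a => (h a).extend (u0 a) (o a) :=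
  (measurable_snoc hh.fst ho).prodMk (measurable_snoc hh.snd hu)

@[simp]
theorem past_extend (h : S.Hist t) (u0 : S.U0) (o : S.Obs) : (h.extend u0 o).past = h := by
  simp [past, extend]

@[simp]
theorem x0_extend (h : S.Hist t) (u0 : S.U0) (o : S.Obs) : (h.extend u0 o).x0 = o.1 := by
  simp [x0, extend]

@[simp]
theorem m0_extend (h : S.Hist t) (u0 : S.U0) (o : S.Obs) : (h.extend u0 o).m0 = o.2.1 := by
  simp [m0, extend]

@[simp]
theorem z_extend (h : S.Hist t) (u0 : S.U0) (o : S.Obs) :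
    (h.extend u0 o).z = o.2.2.map Prod.fst := by
  simp [z, extend]

@[simp]
theorem zt_extend (h : S.Hist t) (u0 : S.U0) (o : S.Obs) :
    (h.extend u0 o).zt = o.2.2.map Prod.snd := by
  simp [zt, extend]

end Hist

/-- Borel measurability of a prescription strategy up to the horizon. -/
structure Strategy.IsMeasurable (φ : S.Strategy) : Prop where
  act : ∀ t ≤ S.T, Measurable (φ.act t)
  prs : ∀ t ≤ S.T, Measurable (fun p : S.Hist t × (S.X1 × S.M1) => φ.prs t p.1 p.2)

theorem Feasible.isMeasurable {Ω : Type*} [MeasurableSpace Ω] {P : Measure Ω} {N : S.Noise P}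
    {φ : S.Strategy} (h : Feasible N φ) : φ.IsMeasurable := ⟨h.measurable_act, h.measurable_prs⟩

theorem Strategy.IsMeasurable.prs_apply {φ : S.Strategy} (hφ : φ.IsMeasurable) {t : ℕ}
    (ht : t ≤ S.T) (h : S.Hist t) : Measurable (φ.prs t h) :=
  (hφ.prs t ht).comp measurable_prodMk_left

/-! ### Mode law and belief as Markov kernels on histories. -/

instance isProbabilityMeasure_modeLaw (zt : Option S.M1) :
    IsProbabilityMeasure (S.modeLaw zt) := by
  cases zt <;> (simp only [modeLaw]; infer_instance)

theorem measurable_modeLaw : Measurable S.modeLaw :=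
  measurable_of_some Measure.measurable_dirac

/-- The law of the local mode given the common information, as a kernel. -/
def modeKernel (t : ℕ) : Kernel (S.Hist t) S.M1 :=
  ⟨fun h => S.modeLaw h.zt, measurable_modeLaw.comp Hist.measurable_zt⟩

instance isMarkovKernel_modeKernel (t : ℕ) : IsMarkovKernel (modeKernel (S := S) t) :=
  ⟨fun h => isProbabilityMeasure_modeLaw h.zt⟩

theorem isProbabilityMeasure_update (t : ℕ) (θ : Measure S.X1) [IsProbabilityMeasure θ] (u0 : S.U0)
    {ρ : S.X1 × S.M1 → S.U1} (hρ : Measurable ρ) (x0 : S.X0) (m0 : S.M0) (zt : Option S.M1)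
    (z : Option S.X1) : IsProbabilityMeasure (S.update t θ u0 ρ x0 m0 zt z) := by
  cases z with
  | some y => simp only [update]; infer_instance
  | none =>
    simp only [update]
    exact Measure.isProbabilityMeasure_map (by fun_prop)

theorem isProbabilityMeasure_belief {φ : S.Strategy} (hφ : φ.IsMeasurable) {t : ℕ} (ht : t ≤ S.T)
    (h : S.Hist t) : IsProbabilityMeasure (belief φ t h) := by
  induction t with
  | zero =>
    rw [belief]
    split <;> infer_instance
  | succ t ih =>
    have := ih (by omega) h.past
    exact isProbabilityMeasure_update _ _ _ (hφ.prs_apply (by omega) _) _ _ _ _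

/-- Pushing a kernel forward by a map that itself depends on the parameter is what the belief update
does after a failed transmission. -/
theorem measurable_map_kernel {β γ : Type*} [MeasurableSpace β] [MeasurableSpace γ]
    (κ : Kernel α β) [IsSFiniteKernel κ] {g : α → β → γ}
    (hg : Measurable fun p : α × β => g p.1 p.2) : Measurable fun a => (κ a).map (g a) := by
  refine Measure.measurable_of_measurable_coe _ fun s hs => ?_
  have h : ∀ a, (κ a).map (g a) s = κ a (Prod.mk a ⁻¹' ((fun p : α × β => g p.1 p.2) ⁻¹' s)) :=
    fun a => by
      rw [Measure.map_apply (f := g a) (hg.comp measurable_prodMk_left) hs]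
      rfl
  simp only [h]
  exact Kernel.measurable_kernel_prodMk_left (hg hs)

/-- By induction over the recursion, treating the two channel outcomes separately: a Dirac mass is
measurable in its location, and the failure branch is a parameter-dependent pushforward of a product
kernel. Joint measurability of the prescription in history and local data enters here. -/
theorem measurable_belief {φ : S.Strategy} (hφ : φ.IsMeasurable) {t : ℕ} (ht : t ≤ S.T) :
    Measurable (belief φ t) := by
  induction t with
  | zero =>
    have h : Measurable fun z : Option S.X1 =>
        (match z with | some y => Measure.dirac y | none => (S.lawX1 : Measure S.X1)) :=
      measurable_of_some Measure.measurable_dirac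
    exact h.comp Hist.measurable_z
  | succ t ih =>
    have ht' : t ≤ S.T := by omega
    have ha := hφ.act t ht'
    have hp := hφ.prs t ht'
    have hM : Measurable (fun p : Option S.X1 × S.Hist t =>
        S.update t (belief φ t p.2) (φ.act t p.2) (φ.prs t p.2) p.2.x0 p.2.m0 p.2.zt p.1) := by
      refine measurable_prod_of_option
        (f := fun z h => S.update t (belief φ t h) (φ.act t h) (φ.prs t h) h.x0 h.m0 h.zt z) ?_ ?_
      · exact Measure.measurable_dirac.comp measurable_fst
      · have : IsMarkovKernel (⟨belief φ t, ih ht'⟩ : Kernel (S.Hist t) S.X1) :=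
          ⟨isProbabilityMeasure_belief hφ ht'⟩
        have h := measurable_map_kernel ((⟨belief φ t, ih ht'⟩ : Kernel (S.Hist t) S.X1) ×ₖ
          (modeKernel t ×ₖ Kernel.const _ (S.lawW1 t : Measure S.X1)))
          (g := fun h (p : S.X1 × S.M1 × S.X1) =>
            S.next1 h.m0 p.2.1 h.x0 p.1 (φ.act t h) (φ.prs t h (p.1, p.2.1)) p.2.2) (by
            have : Measurable fun q : S.Hist t × S.X1 × S.M1 × S.X1 =>
                φ.prs t q.1 (q.2.1, q.2.2.1) :=
              hp.comp (measurable_fst.prodMk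
                (measurable_snd.fst.prodMk measurable_snd.snd.fst))
            fun_prop)
        simp only [Kernel.prod_apply, Kernel.const_apply] at h
        exact h
    exact hM.comp (Hist.measurable_z.prodMk Hist.measurable_past)

/-- The belief on the local state given the common information, as a kernel. -/
def beliefKernel {φ : S.Strategy} (hφ : φ.IsMeasurable) {t : ℕ} (ht : t ≤ S.T) :
    Kernel (S.Hist t) S.X1 :=
  ⟨belief φ t, measurable_belief hφ ht⟩

instance isMarkovKernel_beliefKernel {φ : S.Strategy} (hφ : φ.IsMeasurable) {t : ℕ}
    (ht : t ≤ S.T) : IsMarkovKernel (beliefKernel hφ ht) :=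
  ⟨isProbabilityMeasure_belief hφ ht⟩

/-! ### One step of the system as a kernel on histories. -/

/-- Joint law of the noises at time `t` and of the modes and the link state at time `t + 1`. -/
def innovationLaw (S : SwitchedSystem) (t : ℕ) : Measure (S.X0 × S.X1 × S.M0 × S.M1 × Bool) :=
  (S.lawW0 t : Measure S.X0).prod ((S.lawW1 t : Measure S.X1).prod
    ((S.lawM0 : Measure S.M0).prod ((S.lawM1 : Measure S.M1).prod (S.lawΓ : Measure Bool))))

instance isProbabilityMeasure_innovationLaw (t : ℕ) :
    IsProbabilityMeasure (S.innovationLaw t) := by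
  unfold innovationLaw; infer_instance

theorem lintegral_stepLaw (t : ℕ) (θ : Measure S.X1) [IsProbabilityMeasure θ] (zt : Option S.M1)
    {f : S.X1 × S.M1 × S.X0 × S.X1 × S.M0 × S.M1 × Bool → ℝ≥0∞} (hf : Measurable f) :
    ∫⁻ p, f p ∂(S.stepLaw t θ zt) =
      ∫⁻ x, ∫⁻ m, ∫⁻ q, f (x, m, q) ∂(S.innovationLaw t) ∂(S.modeLaw zt) ∂θ := by
  change ∫⁻ p, f p ∂(θ.prod ((S.modeLaw zt).prod (S.innovationLaw t))) = _
  rw [lintegral_prod _ hf.aemeasurable]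
  refine lintegral_congr fun x => ?_
  rw [lintegral_prod _ (by fun_prop)]

theorem lintegral_innovationLaw (t : ℕ) {f : S.X0 × S.X1 × S.M0 × S.M1 × Bool → ℝ≥0∞}
    (hf : Measurable f) :
    ∫⁻ q, f q ∂(S.innovationLaw t) =
      ∫⁻ w0, ∫⁻ w1, ∫⁻ m0, ∫⁻ m1, ∫⁻ γ, f (w0, w1, m0, m1, γ)
        ∂(S.lawΓ : Measure Bool) ∂(S.lawM1 : Measure S.M1) ∂(S.lawM0 : Measure S.M0)
        ∂(S.lawW1 t : Measure S.X1) ∂(S.lawW0 t : Measure S.X0) := by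
  unfold innovationLaw
  rw [lintegral_prod _ hf.aemeasurable]
  refine lintegral_congr fun w0 => ?_
  rw [lintegral_prod _ (by fun_prop)]
  refine lintegral_congr fun w1 => ?_
  rw [lintegral_prod _ (by fun_prop)]
  refine lintegral_congr fun m0 => ?_
  rw [lintegral_prod _ (by fun_prop)]

/-- The law of one step given the common information, as a kernel. -/
def stepKernel {φ : S.Strategy} (hφ : φ.IsMeasurable) {t : ℕ} (ht : t ≤ S.T) :
    Kernel (S.Hist t) (S.X1 × S.M1 × S.X0 × S.X1 × S.M0 × S.M1 × Bool) :=
  beliefKernel hφ ht ×ₖ (modeKernel t ×ₖ Kernel.const _ (S.innovationLaw t))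

instance isMarkovKernel_stepKernel {φ : S.Strategy} (hφ : φ.IsMeasurable) {t : ℕ} (ht : t ≤ S.T) :
    IsMarkovKernel (stepKernel hφ ht) := by
  unfold stepKernel; infer_instance

theorem stepKernel_apply {φ : S.Strategy} (hφ : φ.IsMeasurable) {t : ℕ} (ht : t ≤ S.T)
    (h : S.Hist t) : stepKernel hφ ht h = S.stepLaw t (belief φ t h) h.zt := by
  simp only [stepKernel, Kernel.prod_apply, Kernel.const_apply]
  rfl

/-- The local state after a step from the common information `h`. -/
def nextLocal (φ : S.Strategy) (t : ℕ) (h : S.Hist t)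
    (p : S.X1 × S.M1 × S.X0 × S.X1 × S.M0 × S.M1 × Bool) : S.X1 :=
  S.next1 h.m0 p.2.1 h.x0 p.1 (φ.act t h) (φ.prs t h (p.1, p.2.1)) p.2.2.2.1

/-- The common information after a step from the common information `h`. -/
def nextHist (φ : S.Strategy) (t : ℕ) (h : S.Hist t)
    (p : S.X1 × S.M1 × S.X0 × S.X1 × S.M0 × S.M1 × Bool) : S.Hist (t + 1) :=
  h.extend (φ.act t h) (S.next0 h.m0 h.x0 (φ.act t h) p.2.2.1, p.2.2.2.2.1,
    S.channel p.2.2.2.2.2.2 (nextLocal φ t h p) p.2.2.2.2.2.1)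

/-- The instantaneous cost under `φ` at the common information `h`. -/
def stageCost (φ : S.Strategy) (t : ℕ) (h : S.Hist t) (x : S.X1) (m : S.M1) : ℝ :=
  S.cost t h.x0 x h.m0 m (φ.act t h) (φ.prs t h (x, m))

theorem measurable_nextLocal {φ : S.Strategy} (hφ : φ.IsMeasurable) {t : ℕ} (ht : t ≤ S.T) :
    Measurable fun q : S.Hist t × (S.X1 × S.M1 × S.X0 × S.X1 × S.M0 × S.M1 × Bool) =>
      nextLocal φ t q.1 q.2 := by
  have ha := hφ.act t ht
  have hp : Measurable fun q : S.Hist t × (S.X1 × S.M1 × S.X0 × S.X1 × S.M0 × S.M1 × Bool) =>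
      φ.prs t q.1 (q.2.1, q.2.2.1) :=
    (hφ.prs t ht).comp (measurable_fst.prodMk (measurable_snd.fst.prodMk measurable_snd.snd.fst))
  unfold nextLocal
  fun_prop

theorem measurable_nextHist {φ : S.Strategy} (hφ : φ.IsMeasurable) {t : ℕ} (ht : t ≤ S.T) :
    Measurable fun q : S.Hist t × (S.X1 × S.M1 × S.X0 × S.X1 × S.M0 × S.M1 × Bool) =>
      nextHist φ t q.1 q.2 := by
  have ha := hφ.act t ht
  have hn := measurable_nextLocal hφ ht
  unfold nextHist
  fun_prop

theorem measurable_stageCost {φ : S.Strategy} (hφ : φ.IsMeasurable) {t : ℕ} (ht : t ≤ S.T) :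
    Measurable fun q : S.Hist t × (S.X1 × S.M1) => stageCost φ t q.1 q.2.1 q.2.2 := by
  have ha := hφ.act t ht
  have hp := hφ.prs t ht
  unfold stageCost
  fun_prop

end SwitchedSystem

/-! ### Independence of the primitive variables and the closed loop. -/

namespace SwitchedSystem

variable {S : SwitchedSystem} {Ω : Type*} [mΩ : MeasurableSpace Ω] {P : Measure Ω}

/-- The σ-algebra generated by a primitive random variable. -/
@[reducible]
def Noise.sigma (N : S.Noise P) : PrimIdx S.T → MeasurableSpace Ω
  | .x0 => MeasurableSpace.comap N.X0 inferInstance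
  | .x1 => MeasurableSpace.comap N.X1 inferInstance
  | .w0 t => MeasurableSpace.comap (N.W0 t) inferInstance
  | .w1 t => MeasurableSpace.comap (N.W1 t) inferInstance
  | .m0 t => MeasurableSpace.comap (N.M0 t) inferInstance
  | .m1 t => MeasurableSpace.comap (N.M1 t) inferInstance
  | .γ t => MeasurableSpace.comap (N.Γ t) inferInstance

theorem Noise.iIndep_sigma (N : S.Noise P) : iIndep N.sigma P := by
  exact N.indep

theorem Noise.sigma_le (N : S.Noise P) (i : PrimIdx S.T) : N.sigma i ≤ mΩ := by
  cases i with
  | x0 => exact N.measurable_X0.comap_le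
  | x1 => exact N.measurable_X1.comap_le
  | w0 t => exact (N.measurable_W0 t (by omega)).comap_le
  | w1 t => exact (N.measurable_W1 t (by omega)).comap_le
  | m0 t => exact (N.measurable_M0 t (by omega)).comap_le
  | m1 t => exact (N.measurable_M1 t (by omega)).comap_le
  | γ t => exact (N.measurable_Γ t (by omega)).comap_le

/-- The σ-algebra generated by a set of primitive random variables. -/
@[reducible]
def Noise.sigmaOf (N : S.Noise P) (A : Set (PrimIdx S.T)) : MeasurableSpace Ω :=
  ⨆ i ∈ A, N.sigma i

theorem Noise.sigmaOf_le (N : S.Noise P) (A : Set (PrimIdx S.T)) : N.sigmaOf A ≤ mΩ :=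
  iSup₂_le fun i _ => N.sigma_le i

theorem Noise.measurable_of_mem (N : S.Noise P) {A : Set (PrimIdx S.T)} {β : Type*}
    [mβ : MeasurableSpace β] {Y : Ω → β} (i : PrimIdx S.T) (hi : i ∈ A)
    (hY : N.sigma i = MeasurableSpace.comap Y mβ) : Measurable[N.sigmaOf A] Y :=
  measurable_iff_comap_le.2 (hY ▸ le_iSup₂_of_le i hi le_rfl)

/-- Disjoint groups of mutually independent σ-algebras generate independent σ-algebras. All product
laws below come from this. -/
theorem Noise.map_prodMk [IsProbabilityMeasure P] (N : S.Noise P) {A B : Set (PrimIdx S.T)}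
    (hAB : Disjoint A B) {β γ : Type*} [MeasurableSpace β] [MeasurableSpace γ] {Y : Ω → β}
    {Z : Ω → γ} (hY : Measurable[N.sigmaOf A] Y) (hZ : Measurable[N.sigmaOf B] Z) :
    P.map (fun ω => (Y ω, Z ω)) = (P.map Y).prod (P.map Z) := by
  have hind : IndepFun Y Z P := by
    rw [IndepFun_iff_Indep]
    exact indep_of_indep_of_le_left (indep_of_indep_of_le_right
      (indep_iSup_of_disjoint N.sigma_le N.iIndep_sigma hAB) hZ.comap_le) hY.comap_le
  exact (indepFun_iff_map_prod_eq_prod_map_map (hY.mono (N.sigmaOf_le A) le_rfl).aemeasurable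
    (hZ.mono (N.sigmaOf_le B) le_rfl).aemeasurable).1 hind

section ClosedLoop

variable (N : S.Noise P) (φ : S.Strategy)

/-- The noises at time `t` together with the modes and the link state at time `t + 1`. -/
def innovation (t : ℕ) (ω : Ω) : S.X0 × S.X1 × S.M0 × S.M1 × Bool :=
  (N.W0 t ω, N.W1 t ω, N.M0 (t + 1) ω, N.M1 (t + 1) ω, N.Γ (t + 1) ω)

theorem m0_hist (t : ℕ) (ω : Ω) : (hist N φ t ω).m0 = N.M0 t ω := by
  cases t with
  | zero => rfl
  | succ t => simp [hist, traj]

/-- The global mode is recorded in the history, so the closed-loop recursion is a fixed map of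
history, local state, local mode and innovation; this is the form that can be integrated against
`stepLaw`. -/
theorem hist_succ (t : ℕ) (ω : Ω) : hist N φ (t + 1) ω =
    nextHist φ t (hist N φ t ω) (state1 N φ t ω, N.M1 t ω, innovation N t ω) := by
  simp only [nextHist, nextLocal, m0_hist]
  rfl

theorem state1_succ (t : ℕ) (ω : Ω) : state1 N φ (t + 1) ω =
    nextLocal φ t (hist N φ t ω) (state1 N φ t ω, N.M1 t ω, innovation N t ω) := by
  simp only [nextLocal, m0_hist]
  rfl

variable {φ}

/-- The σ-algebra `𝓕` is left free because two choices are needed: the ambient one, and the one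
generated by the primitive variables preceding the innovation. -/
theorem measurable_hist_state1 {Ω : Type*} {𝓕 mΩ : MeasurableSpace Ω} {P : Measure Ω}
    (N : S.Noise P) {φ : S.Strategy} (hφ : φ.IsMeasurable) {t : ℕ} (ht : t ≤ S.T)
    (hX0 : Measurable[𝓕] N.X0) (hX1 : Measurable[𝓕] N.X1)
    (hW0 : ∀ s < t, Measurable[𝓕] (N.W0 s)) (hW1 : ∀ s < t, Measurable[𝓕] (N.W1 s))
    (hM0 : ∀ s ≤ t, Measurable[𝓕] (N.M0 s)) (hM1 : ∀ s ≤ t, Measurable[𝓕] (N.M1 s))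
    (hΓ : ∀ s ≤ t, Measurable[𝓕] (N.Γ s)) :
    Measurable[𝓕] (hist N φ t) ∧ Measurable[𝓕] (state1 N φ t) := by
  induction t with
  | zero =>
    refine ⟨?_, hX1⟩
    exact Hist.measurable_start.comp
      (hX0.prodMk ((hM0 0 le_rfl).prodMk ((measurable_channel (S := S) measurable_fst
        measurable_snd.fst measurable_snd.snd).comp
          ((hΓ 0 le_rfl).prodMk (hX1.prodMk (hM1 0 le_rfl))))))
  | succ t ih =>
    obtain ⟨hh, hs⟩ := ih (by omega) (fun s hs => hW0 s (by omega)) (fun s hs => hW1 s (by omega))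
      (fun s hs => hM0 s (by omega)) (fun s hs => hM1 s (by omega)) (fun s hs => hΓ s (by omega))
    have hI : Measurable[𝓕] (innovation N t) :=
      (hW0 t (by omega)).prodMk ((hW1 t (by omega)).prodMk ((hM0 _ le_rfl).prodMk
        ((hM1 _ le_rfl).prodMk (hΓ _ le_rfl))))
    have hp : Measurable[𝓕] fun ω =>
        (hist N φ t ω, state1 N φ t ω, N.M1 t ω, innovation N t ω) :=
      hh.prodMk (hs.prodMk ((hM1 t (by omega)).prodMk hI))
    constructor
    · rw [funext (hist_succ N φ t)]
      have h := (measurable_nextHist hφ (by omega : t ≤ S.T)).comp hp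
      exact h
    · rw [funext (state1_succ N φ t)]
      have h := (measurable_nextLocal hφ (by omega : t ≤ S.T)).comp hp
      exact h

theorem measurable_hist (hφ : φ.IsMeasurable) {t : ℕ} (ht : t ≤ S.T) :
    Measurable (hist N φ t) :=
  (measurable_hist_state1 N hφ ht N.measurable_X0 N.measurable_X1
    (fun s hs => N.measurable_W0 s (by omega)) (fun s hs => N.measurable_W1 s (by omega))
    (fun s hs => N.measurable_M0 s (by omega)) (fun s hs => N.measurable_M1 s (by omega))
    (fun s hs => N.measurable_Γ s (by omega))).1

theorem measurable_state1 (hφ : φ.IsMeasurable) {t : ℕ} (ht : t ≤ S.T) :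
    Measurable (state1 N φ t) :=
  (measurable_hist_state1 N hφ ht N.measurable_X0 N.measurable_X1
    (fun s hs => N.measurable_W0 s (by omega)) (fun s hs => N.measurable_W1 s (by omega))
    (fun s hs => N.measurable_M0 s (by omega)) (fun s hs => N.measurable_M1 s (by omega))
    (fun s hs => N.measurable_Γ s (by omega))).2

/-- Primitive random variables that determine the closed loop up to time `t`. -/
def pastIdx (T t : ℕ) : PrimIdx T → Prop
  | .x0 => True
  | .x1 => True
  | .w0 s => s < t
  | .w1 s => s < t
  | .m0 s => s ≤ t
  | .m1 s => s ≤ t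
  | .γ s => s ≤ t

theorem measurable_past_state (hφ : φ.IsMeasurable) {t : ℕ} (ht : t ≤ S.T) :
    Measurable[N.sigmaOf {i | pastIdx S.T t i}]
      (fun ω => (hist N φ t ω, state1 N φ t ω, N.M1 t ω)) := by
  have hM1 : ∀ s ≤ t, Measurable[N.sigmaOf {i | pastIdx S.T t i}] (N.M1 s) := fun s hs =>
    N.measurable_of_mem (.m1 ⟨s, by omega⟩) hs rfl
  obtain ⟨h1, h2⟩ := measurable_hist_state1 (𝓕 := N.sigmaOf {i | pastIdx S.T t i}) N hφ ht
    (N.measurable_of_mem .x0 trivial rfl) (N.measurable_of_mem .x1 trivial rfl)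
    (fun s hs => N.measurable_of_mem (.w0 ⟨s, by omega⟩) hs rfl)
    (fun s hs => N.measurable_of_mem (.w1 ⟨s, by omega⟩) hs rfl)
    (fun s hs => N.measurable_of_mem (.m0 ⟨s, by omega⟩) hs rfl) hM1
    (fun s hs => N.measurable_of_mem (.γ ⟨s, by omega⟩) hs rfl)
  exact h1.prodMk (h2.prodMk (hM1 t le_rfl))

theorem measurable_innovation {t : ℕ} (ht : t < S.T) :
    Measurable[N.sigmaOf {.w0 ⟨t, by omega⟩, .w1 ⟨t, by omega⟩, .m0 ⟨t + 1, by omega⟩,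
      .m1 ⟨t + 1, by omega⟩, .γ ⟨t + 1, by omega⟩}] (innovation N t) :=
  (N.measurable_of_mem (.w0 ⟨t, by omega⟩) (by simp) rfl).prodMk
    ((N.measurable_of_mem (.w1 ⟨t, by omega⟩) (by simp) rfl).prodMk
    ((N.measurable_of_mem (.m0 ⟨t + 1, by omega⟩) (by simp) rfl).prodMk
    ((N.measurable_of_mem (.m1 ⟨t + 1, by omega⟩) (by simp) rfl).prodMk
    (N.measurable_of_mem (.γ ⟨t + 1, by omega⟩) (by simp) rfl))))

variable [IsProbabilityMeasure P]

theorem map_modes_link {t : ℕ} (ht : t ≤ S.T) :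
    P.map (fun ω => (N.M0 t ω, N.M1 t ω, N.Γ t ω)) = (S.lawM0 : Measure S.M0).prod
      ((S.lawM1 : Measure S.M1).prod (S.lawΓ : Measure Bool)) := by
  have h1 : P.map (fun ω => (N.M1 t ω, N.Γ t ω)) = _ :=
    N.map_prodMk (A := {.m1 ⟨t, by omega⟩}) (B := {.γ ⟨t, by omega⟩}) (by simp)
      (N.measurable_of_mem _ rfl rfl) (N.measurable_of_mem _ rfl rfl)
  have h0 : P.map (fun ω => (N.M0 t ω, N.M1 t ω, N.Γ t ω)) = _ :=
    N.map_prodMk (A := {.m0 ⟨t, by omega⟩}) (B := {.m1 ⟨t, by omega⟩, .γ ⟨t, by omega⟩}) (by simp)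
      (N.measurable_of_mem _ rfl rfl) ((N.measurable_of_mem (.m1 ⟨t, by omega⟩) (by simp) rfl).prodMk
        (N.measurable_of_mem (.γ ⟨t, by omega⟩) (by simp) rfl))
  rw [h0, h1, (N.hasLaw_M0 t ht).map_eq, (N.hasLaw_M1 t ht).map_eq, (N.hasLaw_Γ t ht).map_eq]

theorem map_innovation {t : ℕ} (ht : t < S.T) :
    P.map (innovation N t) = S.innovationLaw t := by
  have h1 : P.map (fun ω => (N.W1 t ω, N.M0 (t + 1) ω, N.M1 (t + 1) ω, N.Γ (t + 1) ω)) = _ :=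
    N.map_prodMk (A := {.w1 ⟨t, by omega⟩})
      (B := {.m0 ⟨t + 1, by omega⟩, .m1 ⟨t + 1, by omega⟩, .γ ⟨t + 1, by omega⟩}) (by simp)
      (N.measurable_of_mem _ rfl rfl)
      ((N.measurable_of_mem (.m0 ⟨t + 1, by omega⟩) (by simp) rfl).prodMk
        ((N.measurable_of_mem (.m1 ⟨t + 1, by omega⟩) (by simp) rfl).prodMk
          (N.measurable_of_mem (.γ ⟨t + 1, by omega⟩) (by simp) rfl)))
  have h0 : P.map (innovation N t) = _ :=
    N.map_prodMk (A := {.w0 ⟨t, by omega⟩})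
      (B := {.w1 ⟨t, by omega⟩, .m0 ⟨t + 1, by omega⟩, .m1 ⟨t + 1, by omega⟩,
        .γ ⟨t + 1, by omega⟩}) (by simp)
      (N.measurable_of_mem _ rfl rfl)
      ((N.measurable_of_mem (.w1 ⟨t, by omega⟩) (by simp) rfl).prodMk
        ((N.measurable_of_mem (.m0 ⟨t + 1, by omega⟩) (by simp) rfl).prodMk
          ((N.measurable_of_mem (.m1 ⟨t + 1, by omega⟩) (by simp) rfl).prodMk
            (N.measurable_of_mem (.γ ⟨t + 1, by omega⟩) (by simp) rfl))))
  rw [h0, h1, map_modes_link N (by omega), (N.hasLaw_W0 t (by omega)).map_eq,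
    (N.hasLaw_W1 t (by omega)).map_eq]
  rfl

/-- History, local state and local mode at time `t` are functions of primitive variables disjoint
from those in the innovation, so the latter can be integrated out separately by Tonelli. -/
theorem lintegral_innovation (hφ : φ.IsMeasurable) {t : ℕ} (ht : t < S.T)
    {F : S.Hist t × (S.X1 × S.M1 × S.X0 × S.X1 × S.M0 × S.M1 × Bool) → ℝ≥0∞} (hF : Measurable F) :
    ∫⁻ ω, F (hist N φ t ω, state1 N φ t ω, N.M1 t ω, innovation N t ω) ∂P =
      ∫⁻ ω, ∫⁻ q, F (hist N φ t ω, state1 N φ t ω, N.M1 t ω, q) ∂(S.innovationLaw t) ∂P := by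
  have hY := measurable_past_state N hφ ht.le
  have hZ := measurable_innovation N ht
  -- Disjointness rests on the index shift: the past contains noises strictly before `t` and modes
  -- and links up to `t`, the innovation contains noises at `t` and modes and link at `t + 1`.
  have hm := N.map_prodMk (by
    rw [Set.disjoint_left]
    rintro i hi hi'
    rcases hi' with rfl | rfl | rfl | rfl | rfl <;> simp [pastIdx] at hi) hY hZ
  rw [map_innovation N ht] at hm
  replace hY := hY.mono (N.sigmaOf_le _) le_rfl
  replace hZ := hZ.mono (N.sigmaOf_le _) le_rfl
  have hG : Measurable fun p : (S.Hist t × S.X1 × S.M1) × (S.X0 × S.X1 × S.M0 × S.M1 × Bool) =>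
      F (p.1.1, p.1.2.1, p.1.2.2, p.2) := by fun_prop
  have h1 := lintegral_map (μ := P) hG (hY.prodMk hZ)
  rw [hm, lintegral_prod _ hG.aemeasurable, lintegral_map hG.lintegral_prod_right' hY] at h1
  exact h1.symm

end ClosedLoop

end SwitchedSystem

/-! ### The belief disintegrates the closed-loop law. -/

namespace SwitchedSystem

variable {S : SwitchedSystem}

/-- Disintegration of `(Z, Z̃, X¹, M¹)` along the channel output, when `X¹` has law `bel none`. -/
theorem lintegral_channel {bel : Option S.X1 → Measure S.X1}
    (hbel : ∀ y, bel (some y) = Measure.dirac y) [IsProbabilityMeasure (bel none)]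
    {G : Option (S.X1 × S.M1) → S.X1 → S.M1 → ℝ≥0∞}
    (hG : Measurable fun q : Option (S.X1 × S.M1) × S.X1 × S.M1 => G q.1 q.2.1 q.2.2) :
    ∫⁻ y, ∫⁻ m, ∫⁻ γ, G (S.channel γ y m) y m
        ∂(S.lawΓ : Measure Bool) ∂(S.lawM1 : Measure S.M1) ∂(bel none) =
      ∫⁻ y, ∫⁻ m, ∫⁻ γ, (∫⁻ x, ∫⁻ m', G (S.channel γ y m) x m'
          ∂(S.modeLaw ((S.channel γ y m).map Prod.snd)) ∂(bel ((S.channel γ y m).map Prod.fst)))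
        ∂(S.lawΓ : Measure Bool) ∂(S.lawM1 : Measure S.M1) ∂(bel none) := by
  have hs : Measurable fun q : S.X1 × S.M1 => G (some (q.1, q.2)) q.1 q.2 :=
    hG.comp ((measurable_some.comp (measurable_fst.prodMk measurable_snd)).prodMk
      (measurable_fst.prodMk measurable_snd))
  have hn : Measurable fun q : S.X1 × S.M1 => G none q.1 q.2 := hG.comp measurable_prodMk_left
  have key : ∀ b : S.X1 → S.M1 → ℝ≥0∞, ∀ c d : ℝ≥0∞,
      ∫⁻ y, ∫⁻ m, (G (some (y, m)) y m * c + b y m * d) ∂(S.lawM1 : Measure S.M1) ∂(bel none) =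
      ∫⁻ y, ∫⁻ m, G (some (y, m)) y m * c ∂(S.lawM1 : Measure S.M1) ∂(bel none) +
        ∫⁻ y, ∫⁻ m, b y m * d ∂(S.lawM1 : Measure S.M1) ∂(bel none) := by
    intro b c d
    rw [← lintegral_add_left (hs.mul_const c).lintegral_prod_right']
    refine lintegral_congr fun y => ?_
    exact lintegral_add_left ((hs.mul_const c).comp measurable_prodMk_left) _
  simp only [lintegral_fintype (α := Bool), Fintype.sum_bool, channel, if_true, Option.map_some,
    Bool.false_eq_true, if_false, Option.map_none, modeLaw, hbel]
  have hdirac : ∀ (y : S.X1) (m : S.M1), ∫⁻ x, ∫⁻ m', G (some (y, m)) x m' ∂(Measure.dirac m)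
      ∂(Measure.dirac y) = G (some (y, m)) y m := fun y m => by
    rw [lintegral_dirac, lintegral_dirac]
  simp only [hdirac, key]
  congr 1
  -- The success terms agree since both inner laws are Dirac. In the failure term the inner double
  -- integral is constant in the outer variables, which therefore integrate to one.
  simp only [lintegral_const, measure_univ, mul_one]
  rw [← lintegral_mul_const _ hn.lintegral_prod_right']
  refine lintegral_congr fun y => ?_
  exact lintegral_mul_const _ (hn.comp measurable_prodMk_left)

/-- The local data `(x1, m1, w1)` enter the integrand only through the next local state, so their
joint law may be replaced by its image, which is `update` at `none`. The remaining variables are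
independent of it, and Tonelli reorders the integrals. -/
theorem lintegral_stepLaw_next (t : ℕ) (θ : Measure S.X1) [IsProbabilityMeasure θ] (u0 : S.U0)
    {ρ : S.X1 × S.M1 → S.U1} (hρ : Measurable ρ) (x0 : S.X0) (m0 : S.M0) (zt : Option S.M1)
    {F : S.X0 → S.M0 → S.X1 → S.M1 → Bool → ℝ≥0∞}
    (hF : Measurable fun q : S.X0 × S.M0 × S.X1 × S.M1 × Bool =>
      F q.1 q.2.1 q.2.2.1 q.2.2.2.1 q.2.2.2.2) :
    ∫⁻ p, F p.2.2.1 p.2.2.2.2.1 (S.next1 m0 p.2.1 x0 p.1 u0 (ρ (p.1, p.2.1)) p.2.2.2.1)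
        p.2.2.2.2.2.1 p.2.2.2.2.2.2 ∂(S.stepLaw t θ zt) =
      ∫⁻ w0, ∫⁻ m0', ∫⁻ y, ∫⁻ m1', ∫⁻ γ, F w0 m0' y m1' γ
        ∂(S.lawΓ : Measure Bool) ∂(S.lawM1 : Measure S.M1)
        ∂(S.update t θ u0 ρ x0 m0 zt none) ∂(S.lawM0 : Measure S.M0)
        ∂(S.lawW0 t : Measure S.X0) := by
  have hpu := isProbabilityMeasure_update t θ u0 hρ x0 m0 zt none
  set ν := S.update t θ u0 ρ x0 m0 zt none with hν
  let G : S.X0 × S.M0 × S.X1 → ℝ≥0∞ := fun q => ∫⁻ m1', ∫⁻ γ, F q.1 q.2.1 q.2.2 m1' γ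
    ∂(S.lawΓ : Measure Bool) ∂(S.lawM1 : Measure S.M1)
  have hG : Measurable G := by
    have h1 : Measurable fun q : (S.X0 × S.M0 × S.X1) × S.M1 =>
        ∫⁻ γ, F q.1.1 q.1.2.1 q.1.2.2 q.2 γ ∂(S.lawΓ : Measure Bool) := by
      refine Measurable.lintegral_prod_right' (f := fun r : ((S.X0 × S.M0 × S.X1) × S.M1) × Bool =>
        F r.1.1.1 r.1.1.2.1 r.1.1.2.2 r.1.2 r.2) ?_
      exact hF.comp (g := fun q : S.X0 × S.M0 × S.X1 × S.M1 × Bool =>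
        F q.1 q.2.1 q.2.2.1 q.2.2.2.1 q.2.2.2.2)
        (f := fun r : ((S.X0 × S.M0 × S.X1) × S.M1) × Bool =>
          (r.1.1.1, r.1.1.2.1, r.1.1.2.2, r.1.2, r.2)) (by fun_prop)
    exact h1.lintegral_prod_right'
  let G2 : S.X0 × S.X1 → ℝ≥0∞ := fun q => ∫⁻ m0', G (q.1, m0', q.2) ∂(S.lawM0 : Measure S.M0)
  have hG2 : Measurable G2 :=
    Measurable.lintegral_prod_right' (f := fun r : (S.X0 × S.X1) × S.M0 => G (r.1.1, r.2, r.1.2))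
      (by fun_prop)
  let n : S.X1 × S.M1 × S.X1 → S.X1 := fun p =>
    S.next1 m0 p.2.1 x0 p.1 u0 (ρ (p.1, p.2.1)) p.2.2
  have hn : Measurable n := by fun_prop
  refine (lintegral_stepLaw _ _ _ (hF.comp (g := fun q : S.X0 × S.M0 × S.X1 × S.M1 × Bool =>
        F q.1 q.2.1 q.2.2.1 q.2.2.2.1 q.2.2.2.2)
        (f := fun p : S.X1 × S.M1 × S.X0 × S.X1 × S.M0 × S.M1 × Bool =>
          (p.2.2.1, p.2.2.2.2.1, S.next1 m0 p.2.1 x0 p.1 u0 (ρ (p.1, p.2.1)) p.2.2.2.1,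
            p.2.2.2.2.2.1, p.2.2.2.2.2.2)) (by fun_prop))).trans ?_
  simp only [Function.comp_apply]
  have hL : ∀ x m, ∫⁻ q, F q.1 q.2.2.1 (S.next1 m0 m x0 x u0 (ρ (x, m)) q.2.1)
      q.2.2.2.1 q.2.2.2.2 ∂(S.innovationLaw t) =
      ∫⁻ w0, ∫⁻ w1, G2 (w0, n (x, m, w1)) ∂(S.lawW1 t : Measure S.X1)
        ∂(S.lawW0 t : Measure S.X0) := fun x m =>
    lintegral_innovationLaw t (hF.comp (g := fun q : S.X0 × S.M0 × S.X1 × S.M1 × Bool =>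
        F q.1 q.2.1 q.2.2.1 q.2.2.2.1 q.2.2.2.2)
        (f := fun q : S.X0 × S.X1 × S.M0 × S.M1 × Bool =>
          (q.1, q.2.2.1, S.next1 m0 m x0 x u0 (ρ (x, m)) q.2.1, q.2.2.2.1, q.2.2.2.2))
            (by fun_prop))
  have hR : ∀ w0, ∫⁻ m0', ∫⁻ y, ∫⁻ m1', ∫⁻ γ, F w0 m0' y m1' γ
        ∂(S.lawΓ : Measure Bool) ∂(S.lawM1 : Measure S.M1) ∂ν ∂(S.lawM0 : Measure S.M0) =
      ∫⁻ x, ∫⁻ m, ∫⁻ w1, G2 (w0, n (x, m, w1)) ∂(S.lawW1 t : Measure S.X1) ∂(S.modeLaw zt) ∂θ := by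
    intro w0
    have h1 : ∫⁻ m0', ∫⁻ y, G (w0, m0', y) ∂ν ∂(S.lawM0 : Measure S.M0) =
        ∫⁻ y, G2 (w0, y) ∂ν :=
      lintegral_lintegral_swap (f := fun m0' y => G (w0, m0', y)) (by
        change AEMeasurable (fun q : S.M0 × S.X1 => G (w0, q.1, q.2)) _
        fun_prop)
    refine h1.trans ?_
    have h2 : ∫⁻ y, G2 (w0, y) ∂ν = ∫⁻ p, G2 (w0, n p)
        ∂(θ.prod ((S.modeLaw zt).prod (S.lawW1 t : Measure S.X1))) := by
      rw [hν, update, lintegral_map (by fun_prop) hn]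
    rw [h2, lintegral_prod _ (by fun_prop)]
    refine lintegral_congr fun x => ?_
    rw [lintegral_prod _ (by fun_prop)]
  have hinner : Measurable fun q : (S.X0 × S.X1) × S.M1 =>
      ∫⁻ w1, G2 (q.1.1, n (q.1.2, q.2, w1)) ∂(S.lawW1 t : Measure S.X1) :=
    Measurable.lintegral_prod_right'
      (f := fun r : ((S.X0 × S.X1) × S.M1) × S.X1 => G2 (r.1.1.1, n (r.1.1.2, r.1.2, r.2)))
      (by fun_prop)
  simp only [hL, hR]
  rw [lintegral_lintegral_swap (f := fun (w0 : S.X0) (x : S.X1) =>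
    ∫⁻ m, ∫⁻ w1, G2 (w0, n (x, m, w1)) ∂(S.lawW1 t : Measure S.X1) ∂(S.modeLaw zt))
    hinner.lintegral_prod_right'.aemeasurable]
  refine lintegral_congr fun x => ?_
  refine lintegral_lintegral_swap (f := fun (m : S.M1) (w0 : S.X0) =>
    ∫⁻ w1, G2 (w0, n (x, m, w1)) ∂(S.lawW1 t : Measure S.X1)) (Measurable.aemeasurable ?_)
  exact hinner.comp (f := fun q : S.M1 × S.X0 => ((q.2, x), q.1)) (by fun_prop)

theorem measurable_lintegral_belief {φ : S.Strategy} (hφ : φ.IsMeasurable) {t : ℕ} (ht : t ≤ S.T)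
    {f : S.Hist t × S.X1 × S.M1 → ℝ≥0∞} (hf : Measurable f) :
    Measurable fun h => ∫⁻ x, ∫⁻ m, f (h, x, m) ∂(S.modeLaw h.zt) ∂(belief φ t h) := by
  have h1 : Measurable fun q : S.Hist t × S.X1 => ∫⁻ m, f (q.1, q.2, m) ∂(S.modeLaw q.1.zt) :=
    Measurable.lintegral_kernel_prod_right' (κ := (modeKernel t).comap Prod.fst measurable_fst)
      (f := fun r : (S.Hist t × S.X1) × S.M1 => f (r.1.1, r.1.2, r.2)) (by fun_prop)
  exact h1.lintegral_kernel_prod_right' (κ := beliefKernel hφ ht)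

theorem belief_extend (φ : S.Strategy) {t : ℕ} (h : S.Hist t) (u0 : S.U0) (o : S.Obs) :
    belief φ (t + 1) (h.extend u0 o) = S.update t (belief φ t h) (φ.act t h) (φ.prs t h)
      h.x0 h.m0 h.zt (o.2.2.map Prod.fst) := by
  simp only [belief, Hist.past_extend, Hist.z_extend]

/-- One-step consistency of the belief: given the common information `h`, averaging over the next
local state and mode is the same as averaging over the next belief. -/
theorem lintegral_stepLaw_belief {φ : S.Strategy} (hφ : φ.IsMeasurable) {t : ℕ} (ht : t < S.T)
    {f : S.Hist (t + 1) × S.X1 × S.M1 → ℝ≥0∞} (hf : Measurable f) (h : S.Hist t) :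
    ∫⁻ p, f (nextHist φ t h p, nextLocal φ t h p, p.2.2.2.2.2.1)
        ∂(S.stepLaw t (belief φ t h) h.zt) =
      ∫⁻ p, ∫⁻ x, ∫⁻ m, f (nextHist φ t h p, x, m) ∂(S.modeLaw (nextHist φ t h p).zt)
        ∂(belief φ (t + 1) (nextHist φ t h p)) ∂(S.stepLaw t (belief φ t h) h.zt) := by
  have hprob := isProbabilityMeasure_belief hφ ht.le h
  have hρ := hφ.prs_apply ht.le h
  have hpu := isProbabilityMeasure_update t (belief φ t h) (φ.act t h) hρ h.x0 h.m0 h.zt none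
  have hg := measurable_lintegral_belief hφ (t := t + 1) ht hf
  have e1 := lintegral_stepLaw_next t (belief φ t h) (φ.act t h) hρ h.x0 h.m0 h.zt
    (F := fun w0 m0' y m1' γ => f (h.extend (φ.act t h)
      (S.next0 h.m0 h.x0 (φ.act t h) w0, m0', S.channel γ y m1'), y, m1')) (by fun_prop)
  have e2 := lintegral_stepLaw_next t (belief φ t h) (φ.act t h) hρ h.x0 h.m0 h.zt
    (F := fun w0 m0' y m1' γ => (fun h' => ∫⁻ x, ∫⁻ m, f (h', x, m) ∂(S.modeLaw h'.zt)
      ∂(belief φ (t + 1) h')) (h.extend (φ.act t h)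
      (S.next0 h.m0 h.x0 (φ.act t h) w0, m0', S.channel γ y m1'))) (hg.comp (by fun_prop))
  refine e1.trans (Eq.trans ?_ e2.symm)
  refine lintegral_congr fun w0 => lintegral_congr fun m0' => ?_
  simp only [belief_extend, Hist.zt_extend]
  exact lintegral_channel
    (bel := S.update t (belief φ t h) (φ.act t h) (φ.prs t h) h.x0 h.m0 h.zt) (fun _ => rfl)
    (G := fun o x m => f (h.extend (φ.act t h)
      (S.next0 h.m0 h.x0 (φ.act t h) w0, m0', o), x, m)) (by fun_prop)

section ClosedLoop

variable {Ω : Type*} [mΩ : MeasurableSpace Ω] {P : Measure Ω} [IsProbabilityMeasure P]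
  (N : S.Noise P) {φ : S.Strategy}

theorem map_initial :
    P.map (fun ω => (N.X0 ω, N.X1 ω, N.M0 0 ω, N.M1 0 ω, N.Γ 0 ω)) =
      (S.lawX0 : Measure S.X0).prod ((S.lawX1 : Measure S.X1).prod ((S.lawM0 : Measure S.M0).prod
        ((S.lawM1 : Measure S.M1).prod (S.lawΓ : Measure Bool)))) := by
  have h1 : P.map (fun ω => (N.X1 ω, N.M0 0 ω, N.M1 0 ω, N.Γ 0 ω)) = _ :=
    N.map_prodMk (A := {.x1}) (B := {.m0 0, .m1 0, .γ 0}) (by simp)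
      (N.measurable_of_mem _ rfl rfl)
      ((N.measurable_of_mem (.m0 0) (by simp) rfl).prodMk
        ((N.measurable_of_mem (.m1 0) (by simp) rfl).prodMk
          (N.measurable_of_mem (.γ 0) (by simp) rfl)))
  have h0 : P.map (fun ω => (N.X0 ω, N.X1 ω, N.M0 0 ω, N.M1 0 ω, N.Γ 0 ω)) = _ :=
    N.map_prodMk (A := {.x0}) (B := {.x1, .m0 0, .m1 0, .γ 0}) (by simp)
      (N.measurable_of_mem _ rfl rfl)
      ((N.measurable_of_mem .x1 (by simp) rfl).prodMk
        ((N.measurable_of_mem (.m0 0) (by simp) rfl).prodMk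
          ((N.measurable_of_mem (.m1 0) (by simp) rfl).prodMk
            (N.measurable_of_mem (.γ 0) (by simp) rfl))))
  rw [h0, h1, map_modes_link N (Nat.zero_le _), N.hasLaw_X0.map_eq, N.hasLaw_X1.map_eq]

theorem lintegral_initial {F : S.X0 → S.M0 → S.X1 → S.M1 → Bool → ℝ≥0∞}
    (hF : Measurable fun q : S.X0 × S.M0 × S.X1 × S.M1 × Bool =>
      F q.1 q.2.1 q.2.2.1 q.2.2.2.1 q.2.2.2.2) :
    ∫⁻ ω, F (N.X0 ω) (N.M0 0 ω) (N.X1 ω) (N.M1 0 ω) (N.Γ 0 ω) ∂P =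
      ∫⁻ x0, ∫⁻ m0, ∫⁻ x1, ∫⁻ m1, ∫⁻ γ, F x0 m0 x1 m1 γ
        ∂(S.lawΓ : Measure Bool) ∂(S.lawM1 : Measure S.M1) ∂(S.lawX1 : Measure S.X1)
        ∂(S.lawM0 : Measure S.M0) ∂(S.lawX0 : Measure S.X0) := by
  let F' : S.X0 × S.X1 × S.M0 × S.M1 × Bool → ℝ≥0∞ := fun q =>
    F q.1 q.2.2.1 q.2.1 q.2.2.2.1 q.2.2.2.2
  have hF' : Measurable F' := hF.comp (g := fun q : S.X0 × S.M0 × S.X1 × S.M1 × Bool =>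
        F q.1 q.2.1 q.2.2.1 q.2.2.2.1 q.2.2.2.2)
        (f := fun q : S.X0 × S.X1 × S.M0 × S.M1 × Bool =>
          (q.1, q.2.2.1, q.2.1, q.2.2.2.1, q.2.2.2.2)) (by fun_prop)
  have hY : Measurable (fun ω => (N.X0 ω, N.X1 ω, N.M0 0 ω, N.M1 0 ω, N.Γ 0 ω)) :=
    N.measurable_X0.prodMk (N.measurable_X1.prodMk ((N.measurable_M0 0 (Nat.zero_le _)).prodMk
      ((N.measurable_M1 0 (Nat.zero_le _)).prodMk (N.measurable_Γ 0 (Nat.zero_le _)))))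
  have h1 := lintegral_map (μ := P) hF' hY
  rw [map_initial, lintegral_prod _ hF'.aemeasurable] at h1
  refine h1.symm.trans (lintegral_congr fun x0 => ?_)
  rw [lintegral_prod _ (by fun_prop)]
  have h2 : ∀ x1, ∫⁻ y, F' (x0, x1, y)
      ∂((S.lawM0 : Measure S.M0).prod ((S.lawM1 : Measure S.M1).prod (S.lawΓ : Measure Bool))) =
      ∫⁻ m0, ∫⁻ q, F' (x0, x1, m0, q) ∂((S.lawM1 : Measure S.M1).prod (S.lawΓ : Measure Bool))
        ∂(S.lawM0 : Measure S.M0) := fun x1 => lintegral_prod _ (by fun_prop)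
  simp only [h2]
  rw [lintegral_lintegral_swap (f := fun (x1 : S.X1) (m0 : S.M0) =>
    ∫⁻ q, F' (x0, x1, m0, q) ∂((S.lawM1 : Measure S.M1).prod (S.lawΓ : Measure Bool)))
    (Measurable.lintegral_prod_right' (f := fun r : (S.X1 × S.M0) × S.M1 × Bool =>
      F' (x0, r.1.1, r.1.2, r.2)) (by fun_prop)).aemeasurable]
  refine lintegral_congr fun m0 => lintegral_congr fun x1 => ?_
  rw [lintegral_prod _ (by fun_prop)]

/-- Base case of the disintegration: the channel argument again, with the prior `lawX1` in place of
the predicted law. -/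
theorem lintegral_belief_zero {f : S.Hist 0 × S.X1 × S.M1 → ℝ≥0∞} (hφ : φ.IsMeasurable)
    (hf : Measurable f) :
    ∫⁻ ω, f (hist N φ 0 ω, state1 N φ 0 ω, N.M1 0 ω) ∂P =
      ∫⁻ ω, ∫⁻ x, ∫⁻ m, f (hist N φ 0 ω, x, m) ∂(S.modeLaw (hist N φ 0 ω).zt)
        ∂(belief φ 0 (hist N φ 0 ω)) ∂P := by
  have hg := measurable_lintegral_belief hφ (t := 0) (Nat.zero_le _) hf
  have e1 := lintegral_initial N
    (F := fun x0 m0 x1 m1 γ => f (Hist.start (x0, m0, S.channel γ x1 m1), x1, m1)) (by fun_prop)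
  have e2 := lintegral_initial N
    (F := fun x0 m0 x1 m1 γ => (fun h' => ∫⁻ x, ∫⁻ m, f (h', x, m) ∂(S.modeLaw h'.zt)
      ∂(belief φ 0 h')) (Hist.start (x0, m0, S.channel γ x1 m1))) (hg.comp (by fun_prop))
  refine e1.trans (Eq.trans ?_ e2.symm)
  refine lintegral_congr fun x0 => lintegral_congr fun m0 => ?_
  let bel : Option S.X1 → Measure S.X1 := fun z =>
    match z with | some y => Measure.dirac y | none => (S.lawX1 : Measure S.X1)
  have : IsProbabilityMeasure (bel none) :=
    inferInstanceAs (IsProbabilityMeasure (S.lawX1 : Measure S.X1))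
  exact lintegral_channel (bel := bel) (fun _ => rfl)
    (G := fun o x m => f (Hist.start (x0, m0, o), x, m)) (by fun_prop)

/-- The disintegration at time `t` is taken as the hypothesis `hB` so that the formula is available
inside the induction that establishes it. -/
theorem lintegral_step_of_belief (hφ : φ.IsMeasurable) {t : ℕ} (ht : t < S.T)
    (hB : ∀ f : S.Hist t × S.X1 × S.M1 → ℝ≥0∞, Measurable f →
      ∫⁻ ω, f (hist N φ t ω, state1 N φ t ω, N.M1 t ω) ∂P =
        ∫⁻ ω, ∫⁻ x, ∫⁻ m, f (hist N φ t ω, x, m) ∂(S.modeLaw (hist N φ t ω).zt)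
          ∂(belief φ t (hist N φ t ω)) ∂P)
    {F : S.Hist t × (S.X1 × S.M1 × S.X0 × S.X1 × S.M0 × S.M1 × Bool) → ℝ≥0∞} (hF : Measurable F) :
    ∫⁻ ω, F (hist N φ t ω, state1 N φ t ω, N.M1 t ω, innovation N t ω) ∂P =
      ∫⁻ ω, ∫⁻ p, F (hist N φ t ω, p)
        ∂(S.stepLaw t (belief φ t (hist N φ t ω)) (hist N φ t ω).zt) ∂P := by
  rw [lintegral_innovation N hφ ht hF]
  refine (hB (fun r => ∫⁻ q, F (r.1, r.2.1, r.2.2, q) ∂(S.innovationLaw t))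
    (Measurable.lintegral_prod_right' (f := fun r : (S.Hist t × S.X1 × S.M1) ×
      (S.X0 × S.X1 × S.M0 × S.M1 × Bool) => F (r.1.1, r.1.2.1, r.1.2.2, r.2))
        (by fun_prop))).trans (lintegral_congr fun ω => ?_)
  have := isProbabilityMeasure_belief hφ ht.le (hist N φ t ω)
  rw [lintegral_stepLaw t _ _ (by fun_prop)]

/-- The belief and the mode law disintegrate the joint law of the common information, the local
state and the local mode. -/
theorem lintegral_belief (hφ : φ.IsMeasurable) {t : ℕ} (ht : t ≤ S.T)
    {f : S.Hist t × S.X1 × S.M1 → ℝ≥0∞} (hf : Measurable f) :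
    ∫⁻ ω, f (hist N φ t ω, state1 N φ t ω, N.M1 t ω) ∂P =
      ∫⁻ ω, ∫⁻ x, ∫⁻ m, f (hist N φ t ω, x, m) ∂(S.modeLaw (hist N φ t ω).zt)
        ∂(belief φ t (hist N φ t ω)) ∂P := by
  induction t with
  | zero => exact lintegral_belief_zero N hφ hf
  | succ t ih =>
    have hnH := measurable_nextHist hφ (t := t) (by omega)
    have hnL := measurable_nextLocal hφ (t := t) (by omega)
    have hstep := fun F hF => lintegral_step_of_belief N hφ (t := t) ht
      (fun f hf => ih (by omega) hf) (F := F) hF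
    simp only [hist_succ, state1_succ]
    -- Both sides are functions of the history at `t` and one step, so both become integrals against
    -- `stepLaw`; one-step consistency then matches them for each `ω`.
    refine (hstep (fun r => f (nextHist φ t r.1 r.2, nextLocal φ t r.1 r.2, r.2.2.2.2.2.2.1))
      (by fun_prop)).trans (Eq.trans ?_ (hstep (fun r => (fun h' => ∫⁻ x, ∫⁻ m, f (h', x, m)
        ∂(S.modeLaw h'.zt) ∂(belief φ (t + 1) h')) (nextHist φ t r.1 r.2))
        ((measurable_lintegral_belief hφ ht hf).comp hnH)).symm)
    exact lintegral_congr fun ω => lintegral_stepLaw_belief hφ ht hf _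

theorem lintegral_step (hφ : φ.IsMeasurable) {t : ℕ} (ht : t < S.T)
    {F : S.Hist t × (S.X1 × S.M1 × S.X0 × S.X1 × S.M0 × S.M1 × Bool) → ℝ≥0∞} (hF : Measurable F) :
    ∫⁻ ω, F (hist N φ t ω, state1 N φ t ω, N.M1 t ω, innovation N t ω) ∂P =
      ∫⁻ ω, ∫⁻ p, F (hist N φ t ω, p)
        ∂(S.stepLaw t (belief φ t (hist N φ t ω)) (hist N φ t ω).zt) ∂P :=
  lintegral_step_of_belief N hφ ht (fun _ hf => lintegral_belief N hφ ht.le hf) hF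

end ClosedLoop

end SwitchedSystem

/-! ### Second moments and the cost-to-go. -/

namespace SwitchedSystem

variable {S : SwitchedSystem}

/-- The quadratic form has a positive minimum on the compact unit sphere, and homogeneity of degree
two extends the bound. An empty sphere forces every vector to vanish. -/
theorem exists_norm_sq_le_of_posDef {n : Type*} [Fintype n] {A : Matrix n n ℝ} (hA : A.PosDef) :
    ∃ C, 0 ≤ C ∧ ∀ u : n → ℝ, ‖u‖ ^ 2 ≤ C * (u ⬝ᵥ (A *ᵥ u)) := by
  rcases (Metric.sphere (0 : n → ℝ) 1).eq_empty_or_nonempty with he | hne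
  · refine ⟨0, le_rfl, fun u => ?_⟩
    have hu : u = 0 := by
      by_contra hu
      have : ‖u‖⁻¹ • u ∈ Metric.sphere (0 : n → ℝ) 1 := by
        simp [norm_smul, inv_mul_cancel₀ (norm_ne_zero_iff.2 hu)]
      simp [he] at this
    simp [hu]
  · have hc : Continuous fun u : n → ℝ => u ⬝ᵥ (A *ᵥ u) := by
      simp only [dotProduct, Matrix.mulVec]
      fun_prop
    obtain ⟨v, hv, hmin⟩ := (isCompact_sphere (0 : n → ℝ) 1).exists_isMinOn hne hc.continuousOn
    have hv0 : v ≠ 0 := by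
      rintro rfl
      simp at hv
    have hpos : 0 < v ⬝ᵥ (A *ᵥ v) := by simpa using hA.dotProduct_mulVec_pos hv0
    refine ⟨(v ⬝ᵥ (A *ᵥ v))⁻¹, by positivity, fun u => ?_⟩
    by_cases hu : u = 0
    · simp [hu]
    have hn : 0 < ‖u‖ := norm_pos_iff.2 hu
    have h1 : v ⬝ᵥ (A *ᵥ v) ≤ (‖u‖⁻¹ • u) ⬝ᵥ (A *ᵥ (‖u‖⁻¹ • u)) :=
      hmin (by simp [norm_smul, inv_mul_cancel₀ hn.ne'])
    rw [Matrix.mulVec_smul, smul_dotProduct, dotProduct_smul, smul_eq_mul, smul_eq_mul,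
      ← mul_assoc, ← mul_inv, ← sq, le_inv_mul_iff₀ (by positivity)] at h1
    rwa [le_inv_mul_iff₀ hpos, mul_comm]

theorem quadratic_nonneg {n : Type*} [Fintype n] {A : Matrix n n ℝ} (hA : A.PosSemidef)
    (u : n → ℝ) : 0 ≤ u ⬝ᵥ (A *ᵥ u) := by
  simpa using hA.dotProduct_mulVec_nonneg u

theorem cost_nonneg {t : ℕ} (ht : t ≤ S.T) (x0 : S.X0) (x1 : S.X1) (m0 : S.M0) (m1 : S.M1)
    (u0 : S.U0) (u1 : S.U1) : 0 ≤ S.cost t x0 x1 m0 m1 u0 u1 :=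
  add_nonneg (quadratic_nonneg (S.Q_posSemidef t ht m0 m1) _)
    (quadratic_nonneg (S.R_posDef t ht m0 m1).posSemidef _)

/-- The cost controls the squared norm of the local action. -/
theorem exists_norm_sq_le_cost {t : ℕ} (ht : t ≤ S.T) (m0 : S.M0) :
    ∃ C, 0 ≤ C ∧ ∀ x0 x1 m1 u0 u1, ‖u1‖ ^ 2 ≤ C * S.cost t x0 x1 m0 m1 u0 u1 := by
  choose C hC hC' using fun m1 => exists_norm_sq_le_of_posDef (S.R_posDef t ht m0 m1)
  refine ⟨∑ m1, C m1, Finset.sum_nonneg fun _ _ => hC _, fun x0 x1 m1 u0 u1 => ?_⟩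
  have h1 : ‖u1‖ ≤ ‖Sum.elim u0 u1‖ :=
    (pi_norm_le_iff_of_nonneg (norm_nonneg _)).2 fun i => norm_le_pi_norm (Sum.elim u0 u1) (.inr i)
  calc ‖u1‖ ^ 2 ≤ ‖Sum.elim u0 u1‖ ^ 2 := by gcongr
    _ ≤ C m1 * (Sum.elim u0 u1 ⬝ᵥ (S.R t m0 m1 *ᵥ Sum.elim u0 u1)) := hC' _ _
    _ ≤ C m1 * S.cost t x0 x1 m0 m1 u0 u1 :=
      mul_le_mul_of_nonneg_left
        (le_add_of_nonneg_left (quadratic_nonneg (S.Q_posSemidef t ht m0 m1) _)) (hC m1)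
    _ ≤ (∑ m1, C m1) * S.cost t x0 x1 m0 m1 u0 u1 :=
      mul_le_mul_of_nonneg_right
        (Finset.single_le_sum (f := C) (fun m _ => hC m) (Finset.mem_univ m1))
        (cost_nonneg ht _ _ _ _ _ _)

theorem memLp_mulVec {α ι m n : Type*} [MeasurableSpace α] {μ : Measure α} [Finite ι]
    [MeasurableSpace ι] [MeasurableSingletonClass ι] [Fintype m] [Fintype n] (A : ι → Matrix m n ℝ)
    {i : α → ι} {v : α → n → ℝ} (hi : Measurable i) (hvm : Measurable v) (hv : MemLp v 2 μ) :
    MemLp (fun a => A (i a) *ᵥ v a) 2 μ := by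
  have := Fintype.ofFinite ι
  refine hv.of_le_mul (c := ∑ j, ‖(Matrix.mulVecLin (A j)).toContinuousLinearMap‖)
    (measurable_mulVec A hi hvm).aestronglyMeasurable (ae_of_all _ fun a => ?_)
  refine ((Matrix.mulVecLin (A (i a))).toContinuousLinearMap.le_opNorm (v a)).trans ?_
  exact mul_le_mul_of_nonneg_right (Finset.single_le_sum
    (f := fun j => ‖(Matrix.mulVecLin (A j)).toContinuousLinearMap‖)
    (fun _ _ => norm_nonneg _) (Finset.mem_univ (i a))) (norm_nonneg _)

theorem memLp_id_dirac (y : S.X1) : MemLp id 2 (Measure.dirac y) :=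
  (memLp_const y).ae_eq (ae_eq_dirac id).symm

/-- A prescription of finite expected instantaneous cost leads to a belief of finite second
moment. -/
theorem memLp_update {t : ℕ} (ht : t ≤ S.T) {θ : Measure S.X1} [IsProbabilityMeasure θ]
    (hθ : MemLp id 2 θ) (u0 : S.U0) {ρ : S.X1 × S.M1 → S.U1} (hρ : Measurable ρ) (x0 : S.X0)
    (m0 : S.M0) (zt : Option S.M1)
    (hc : ∫⁻ x, ∫⁻ m, ENNReal.ofReal (S.cost t x0 x m0 m u0 (ρ (x, m))) ∂(S.modeLaw zt) ∂θ ≠ ⊤)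
    (z : Option S.X1) : MemLp id 2 (S.update t θ u0 ρ x0 m0 zt z) := by
  cases z with
  | some y => exact memLp_id_dirac y
  | none =>
    rw [update, memLp_map_measure_iff measurable_id.aestronglyMeasurable (by fun_prop)]
    set μ := θ.prod ((S.modeLaw zt).prod (S.lawW1 t : Measure S.X1))
    have hx : MemLp (fun p : S.X1 × S.M1 × S.X1 => p.1) 2 μ :=
      hθ.comp_measurePreserving measurePreserving_fst
    have hw : MemLp (fun p : S.X1 × S.M1 × S.X1 => p.2.2) 2 μ :=
      (S.lawW1_memLp t ht).comp_measurePreserving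
        ((measurePreserving_snd (μ := S.modeLaw zt)).comp measurePreserving_snd)
    -- The prescribed action is the only term whose second moment is not given; the expected stage
    -- cost bounds it.
    have hu : MemLp (fun p : S.X1 × S.M1 × S.X1 => ρ (p.1, p.2.1)) 2 μ := by
      have hm : Measurable fun p : S.X1 × S.M1 × S.X1 => ρ (p.1, p.2.1) := by fun_prop
      rw [memLp_two_iff_integrable_sq_norm hm.aestronglyMeasurable]
      refine ⟨(hm.norm.pow_const 2).aestronglyMeasurable, ?_⟩
      rw [hasFiniteIntegral_iff_ofReal (ae_of_all _ fun _ => by positivity)]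
      obtain ⟨C, hC, hCle⟩ := exists_norm_sq_le_cost ht m0
      have hcm : Measurable fun p : S.X1 × S.M1 × S.X1 =>
          ENNReal.ofReal (S.cost t x0 p.1 m0 p.2.1 u0 (ρ (p.1, p.2.1))) := by fun_prop
      calc ∫⁻ p, ENNReal.ofReal (‖ρ (p.1, p.2.1)‖ ^ 2) ∂μ
          ≤ ∫⁻ p, ENNReal.ofReal C *
              ENNReal.ofReal (S.cost t x0 p.1 m0 p.2.1 u0 (ρ (p.1, p.2.1))) ∂μ := by
            refine lintegral_mono fun p => ?_
            rw [← ENNReal.ofReal_mul hC]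
            exact ENNReal.ofReal_le_ofReal (hCle _ _ _ _ _)
        _ = ENNReal.ofReal C * ∫⁻ x, ∫⁻ m,
              ENNReal.ofReal (S.cost t x0 x m0 m u0 (ρ (x, m))) ∂(S.modeLaw zt) ∂θ := by
            rw [lintegral_const_mul _ hcm, lintegral_prod _ hcm.aemeasurable]
            congr 1
            refine lintegral_congr fun x => ?_
            rw [lintegral_prod _ (by fun_prop)]
            simp
        _ < ⊤ := ENNReal.mul_lt_top ENNReal.ofReal_lt_top hc.lt_top
    have hm1 : Measurable fun p : S.X1 × S.M1 × S.X1 => p.2.1 := by fun_prop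
    exact ((((memLp_mulVec (S.A10 m0) hm1 measurable_const (memLp_const x0)).add
      (memLp_mulVec (S.A11 m0) hm1 measurable_fst hx)).add
      (memLp_mulVec (S.B10 m0) hm1 measurable_const (memLp_const u0))).add
      (memLp_mulVec (S.B11 m0) hm1 (by fun_prop) hu)).add hw

/-- Expected cost of the `n` stages from time `t` on under `φ`, given the common information. -/
def costToGo (φ : S.Strategy) : ℕ → (t : ℕ) → S.Hist t → ℝ≥0∞
  | 0, _, _ => 0
  | n + 1, t, h => ∫⁻ p, (ENNReal.ofReal (stageCost φ t h p.1 p.2.1) +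
      costToGo φ n (t + 1) (nextHist φ t h p)) ∂(S.stepLaw t (belief φ t h) h.zt)

theorem measurable_ofReal_stageCost {φ : S.Strategy} (hφ : φ.IsMeasurable) {t : ℕ} (ht : t ≤ S.T) :
    Measurable fun q : S.Hist t × (S.X1 × S.M1 × S.X0 × S.X1 × S.M0 × S.M1 × Bool) =>
      ENNReal.ofReal (stageCost φ t q.1 q.2.1 q.2.2.1) :=
  ENNReal.measurable_ofReal.comp ((measurable_stageCost hφ ht).comp
    (measurable_fst.prodMk (measurable_snd.fst.prodMk measurable_snd.snd.fst)))

theorem measurable_costToGo {φ : S.Strategy} (hφ : φ.IsMeasurable) {n t : ℕ}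
    (hn : t + n ≤ S.T + 1) : Measurable (costToGo φ n t) := by
  induction n generalizing t with
  | zero => exact measurable_const
  | succ n ih =>
    have ht : t ≤ S.T := by omega
    have h1 := measurable_nextHist hφ ht
    have h2 := measurable_ofReal_stageCost hφ ht
    have h3 := ih (t := t + 1) (by omega)
    have h := Measurable.lintegral_kernel_prod_right' (κ := stepKernel hφ ht) (h2.add (h3.comp h1))
    simp only [stepKernel_apply] at h
    exact h

theorem lintegral_stepLaw_stageCost {φ : S.Strategy} (hφ : φ.IsMeasurable) {t : ℕ} (ht : t ≤ S.T)
    (h : S.Hist t) :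
    ∫⁻ p, ENNReal.ofReal (stageCost φ t h p.1 p.2.1) ∂(S.stepLaw t (belief φ t h) h.zt) =
      ∫⁻ x, ∫⁻ m, ENNReal.ofReal (stageCost φ t h x m) ∂(S.modeLaw h.zt) ∂(belief φ t h) := by
  have := isProbabilityMeasure_belief hφ ht h
  refine (lintegral_stepLaw _ _ _
    ((measurable_ofReal_stageCost hφ ht).comp measurable_prodMk_left)).trans ?_
  simp

theorem costToGo_succ {φ : S.Strategy} (hφ : φ.IsMeasurable) (n : ℕ) {t : ℕ} (ht : t ≤ S.T)
    (h : S.Hist t) :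
    costToGo φ (n + 1) t h =
      ∫⁻ x, ∫⁻ m, ENNReal.ofReal (stageCost φ t h x m) ∂(S.modeLaw h.zt) ∂(belief φ t h) +
        ∫⁻ p, costToGo φ n (t + 1) (nextHist φ t h p) ∂(S.stepLaw t (belief φ t h) h.zt) := by
  rw [costToGo, ← lintegral_stepLaw_stageCost hφ ht h]
  exact lintegral_add_left ((measurable_ofReal_stageCost hφ ht).comp measurable_prodMk_left) _

theorem integrable_quadratic {α ι n : Type*} [MeasurableSpace α] {μ : Measure α} [Finite ι]
    [MeasurableSpace ι] [MeasurableSingletonClass ι] [Fintype n]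
    (A : ι → Matrix n n ℝ) {i : α → ι} {v : α → n → ℝ} (hi : Measurable i)
    (hvm : Measurable v) (hv : MemLp v 2 μ) :
    Integrable (fun a => v a ⬝ᵥ (A (i a) *ᵥ v a)) μ := by
  have hA := memLp_mulVec A hi hvm hv
  simp only [dotProduct]
  exact integrable_finsetSum _ fun j _ => (hv.eval j).integrable_mul (hA.eval j)

theorem memLp_sumElim {α m n : Type*} [MeasurableSpace α] {μ : Measure α} [Fintype m] [Fintype n]
    {u : α → m → ℝ} {v : α → n → ℝ} (hu : MemLp u 2 μ) (hv : MemLp v 2 μ) :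
    MemLp (fun a => Sum.elim (u a) (v a)) 2 μ := by
  refine MemLp.of_eval fun k => ?_
  cases k with
  | inl i => exact hu.eval i
  | inr i => exact hv.eval i

section ClosedLoop

variable {Ω : Type*} [mΩ : MeasurableSpace Ω] {P : Measure Ω} (N : S.Noise P) {φ : S.Strategy}

theorem totalCost_nonneg (φ : S.Strategy) : 0 ≤ totalCost N φ :=
  integral_nonneg fun _ => Finset.sum_nonneg fun _ ht =>
    cost_nonneg (Nat.lt_succ_iff.1 (Finset.mem_range.1 ht)) _ _ _ _ _ _

/-- The second-moment clauses of feasibility are needed here: `totalCost` is a Bochner integral,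
which would be zero for a non-integrable cost. -/
theorem integrable_stageCost (hφ : Feasible N φ) {t : ℕ} (ht : t ≤ S.T) :
    Integrable (fun ω => stageCost φ t (hist N φ t ω) (state1 N φ t ω) (N.M1 t ω)) P := by
  have hh := measurable_hist N hφ.isMeasurable ht
  have hs := measurable_state1 N hφ.isMeasurable ht
  have hM := N.measurable_M1 t ht
  have h0 : Measurable (state0 N φ t) := Hist.measurable_x0.comp hh
  have ha : Measurable (ctrl0 N φ t) := (hφ.measurable_act t ht).comp hh
  have hp : Measurable (ctrl1 N φ t) := (hφ.measurable_prs t ht).comp (hh.prodMk (hs.prodMk hM))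
  have hm : Measurable fun ω => ((hist N φ t ω).m0, N.M1 t ω) :=
    (Hist.measurable_m0.comp hh).prodMk hM
  have hQ := integrable_quadratic (fun q : S.M0 × S.M1 => S.Q t q.1 q.2) hm
    (measurable_sumElim h0 hs) (memLp_sumElim (hφ.state0_memLp t ht) (hφ.state1_memLp t ht))
  have hR := integrable_quadratic (fun q : S.M0 × S.M1 => S.R t q.1 q.2) hm
    (measurable_sumElim ha hp) (memLp_sumElim (hφ.ctrl0_memLp t ht) (hφ.ctrl1_memLp t ht))
  exact hQ.add hR

variable [IsProbabilityMeasure P]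

/-- Tower property: the disintegration turns the belief-averaged stage cost into the actual one, and
`lintegral_step` advances the remaining cost-to-go by one time unit. -/
theorem lintegral_costToGo (hφ : φ.IsMeasurable) {n t : ℕ} (hn : t + n = S.T + 1) :
    ∫⁻ ω, costToGo φ n t (hist N φ t ω) ∂P = ∑ s ∈ Finset.range n,
      ∫⁻ ω, ENNReal.ofReal (stageCost φ (t + s) (hist N φ (t + s) ω) (state1 N φ (t + s) ω)
        (N.M1 (t + s) ω)) ∂P := by
  induction n generalizing t with
  | zero => simp [costToGo]
  | succ n ih =>
    have ht : t ≤ S.T := by omega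
    have hc : Measurable fun q : S.Hist t × S.X1 × S.M1 =>
        ENNReal.ofReal (stageCost φ t q.1 q.2.1 q.2.2) :=
      ENNReal.measurable_ofReal.comp (measurable_stageCost hφ ht)
    simp only [costToGo_succ hφ n ht]
    refine (lintegral_add_left
      ((measurable_lintegral_belief hφ ht hc).comp (measurable_hist N hφ ht)) _).trans ?_
    rw [Finset.sum_range_succ', add_comm]
    refine congrArg₂ _ ?_ (lintegral_belief N hφ ht hc).symm
    -- At the last stage `t = S.T` the innovation would involve modes beyond the horizon, which have
    -- no prescribed law; the remaining cost-to-go is zero there.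
    rcases Nat.eq_zero_or_pos n with rfl | hn0
    · simp [costToGo]
    · have h1 := lintegral_step N hφ (t := t) (by omega)
        (F := fun q => costToGo φ n (t + 1) (nextHist φ t q.1 q.2))
        ((measurable_costToGo hφ (by omega)).comp (measurable_nextHist hφ ht))
      rw [← h1]
      simp only [← hist_succ]
      rw [ih (by omega)]
      refine Finset.sum_congr rfl fun s _ => ?_
      rw [show t + 1 + s = t + (s + 1) by ring]

theorem ofReal_totalCost (hφ : Feasible N φ) :
    ENNReal.ofReal (totalCost N φ) =
      ∫⁻ ω, costToGo φ (S.T + 1) 0 (hist N φ 0 ω) ∂P := by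
  have hle : ∀ {t}, t ∈ Finset.range (S.T + 1) → t ≤ S.T := fun ht =>
    Nat.lt_succ_iff.1 (Finset.mem_range.1 ht)
  have hcost : totalCost N φ = ∫ ω, ∑ t ∈ Finset.range (S.T + 1),
      stageCost φ t (hist N φ t ω) (state1 N φ t ω) (N.M1 t ω) ∂P := by
    simp only [stageCost, m0_hist]
    rfl
  have hnn : ∀ t ∈ Finset.range (S.T + 1), ∀ ω,
      0 ≤ stageCost φ t (hist N φ t ω) (state1 N φ t ω) (N.M1 t ω) := fun t ht ω =>
    cost_nonneg (hle ht) _ _ _ _ _ _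
  rw [hcost, lintegral_costToGo N hφ.isMeasurable (by omega), integral_finsetSum _ fun t ht =>
    integrable_stageCost N hφ (hle ht), ENNReal.ofReal_sum_of_nonneg fun t ht =>
      integral_nonneg (hnn t ht)]
  refine Finset.sum_congr rfl fun t ht => ?_
  rw [zero_add, ofReal_integral_eq_lintegral_ofReal (integrable_stageCost N hφ (hle ht))
    (ae_of_all _ (hnn t ht))]

end ClosedLoop

end SwitchedSystem

/-! ### Verification of the dynamic program and the conditional law. -/

namespace SwitchedSystem

variable {S : SwitchedSystem}

theorem extendTop_nonneg {v : S.Belief → ℝ} (hv : ∀ θ, 0 ≤ v θ) (θ : Measure S.X1) :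
    0 ≤ extendTop v θ := by
  unfold extendTop
  split
  · exact_mod_cast hv _
  · exact le_top

theorem toENNReal_extendTop {v : S.Belief → ℝ} {θ : Measure S.X1}
    (hθ : IsProbabilityMeasure θ ∧ MemLp id 2 θ) :
    (extendTop v θ).toENNReal = ENNReal.ofReal (v ⟨θ, hθ⟩) := by
  rw [extendTop, dif_pos hθ, EReal.toENNReal_of_ne_top (EReal.coe_ne_top _), EReal.toReal_coe]

theorem eexpect_of_nonneg {α : Type*} [MeasurableSpace α] (μ : Measure α) {f : α → EReal}
    (hf : ∀ a, 0 ≤ f a) : eexpect μ f = ((∫⁻ a, (f a).toENNReal ∂μ : ℝ≥0∞) : EReal) := by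
  have h : ∀ a, (-f a).toENNReal = 0 := fun a =>
    EReal.toENNReal_of_nonpos (EReal.neg_le_zero.2 (hf a))
  simp [eexpect, h]

theorem dpObjective_eq {V : S.ValueFn} {t : ℕ} (ht : t ≤ S.T)
    (hV : ∀ x0 m0 θ zt, 0 ≤ V (t + 1) x0 m0 θ zt) (x0 : S.X0) (m0 : S.M0) (θ : S.Belief)
    (zt : Option S.M1) (u0 : S.U0) (ρ : S.X1 × S.M1 → S.U1) :
    S.dpObjective V t x0 m0 θ zt u0 ρ = ((∫⁻ p,
      (ENNReal.ofReal (S.cost t x0 p.1 m0 p.2.1 u0 (ρ (p.1, p.2.1))) +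
        (extendTop (fun θ' => V (t + 1) (S.next0 m0 x0 u0 p.2.2.1) p.2.2.2.2.1 θ'
          ((S.channel p.2.2.2.2.2.2 (S.next1 m0 p.2.1 x0 p.1 u0 (ρ (p.1, p.2.1)) p.2.2.2.1)
            p.2.2.2.2.2.1).map Prod.snd)) (S.update t θ.1 u0 ρ x0 m0 zt
          ((S.channel p.2.2.2.2.2.2 (S.next1 m0 p.2.1 x0 p.1 u0 (ρ (p.1, p.2.1)) p.2.2.2.1)
            p.2.2.2.2.2.1).map Prod.fst))).toENNReal)
      ∂(S.stepLaw t θ.1 zt) : ℝ≥0∞) : EReal) := by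
  have hc : ∀ x1 m1 u1, (0 : EReal) ≤ ((S.cost t x0 x1 m0 m1 u0 u1 : ℝ) : EReal) :=
    fun x1 m1 u1 => by exact_mod_cast cost_nonneg ht _ _ _ _ _ _
  have he := fun y0 m0' z => extendTop_nonneg (fun θ' => hV y0 m0' θ' z)
  rw [dpObjective, eexpect_of_nonneg _ fun p => add_nonneg (hc _ _ _) (he _ _ _ _)]
  refine congrArg _ (lintegral_congr fun p => ?_)
  rw [EReal.toENNReal_add (hc _ _ _) (he _ _ _ _),
    EReal.toENNReal_of_ne_top (EReal.coe_ne_top _), EReal.toReal_coe]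

/-- Backward induction: each value is attained, so it equals the expectation of a stage cost plus a
next value, both nonnegative. -/
theorem SolvesDP.nonneg {V : S.ValueFn} (hV : S.SolvesDP V) {n t : ℕ} (hn : t + n = S.T + 1)
    (x0 : S.X0) (m0 : S.M0) (θ : S.Belief) (zt : Option S.M1) : 0 ≤ V t x0 m0 θ zt := by
  induction n generalizing t x0 m0 θ zt with
  | zero =>
    obtain rfl : t = S.T + 1 := by omega
    exact (hV.terminal _ _ _ _).ge
  | succ n ih =>
    obtain ⟨u0, ρ, -, h⟩ := (hV.step t (by omega) x0 m0 θ zt).1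
    rw [dpObjective_eq (by omega) (ih (by omega))] at h
    exact_mod_cast h.symm ▸ EReal.coe_ennreal_nonneg _

/-- Rewrites the objective along `nextHist`, so that it has the shape of the recursion for
`costToGo` with the next value in place of the next cost-to-go. -/
theorem dpObjective_strategy {V : S.ValueFn} {t : ℕ} (ht : t ≤ S.T)
    (hV : ∀ x0 m0 θ zt, 0 ≤ V (t + 1) x0 m0 θ zt) (φ : S.Strategy) (h : S.Hist t) (θ : S.Belief)
    (hθ : θ.1 = belief φ t h) :
    S.dpObjective V t h.x0 h.m0 θ h.zt (φ.act t h) (φ.prs t h) = ((∫⁻ p,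
      (ENNReal.ofReal (stageCost φ t h p.1 p.2.1) +
        (extendTop (fun θ' => V (t + 1) (nextHist φ t h p).x0 (nextHist φ t h p).m0 θ'
          (nextHist φ t h p).zt) (belief φ (t + 1) (nextHist φ t h p))).toENNReal)
      ∂(S.stepLaw t (belief φ t h) h.zt) : ℝ≥0∞) : EReal) := by
  rw [dpObjective_eq ht hV, hθ]
  simp only [nextHist, belief_extend, Hist.x0_extend, Hist.m0_extend, Hist.zt_extend]
  rfl

theorem belief_nextHist_mem {φ : S.Strategy} (hφ : φ.IsMeasurable) {t : ℕ} (ht : t ≤ S.T)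
    {h : S.Hist t} (hθ : MemLp id 2 (belief φ t h))
    (hc : ∫⁻ p, ENNReal.ofReal (stageCost φ t h p.1 p.2.1)
      ∂(S.stepLaw t (belief φ t h) h.zt) ≠ ⊤)
    (p : S.X1 × S.M1 × S.X0 × S.X1 × S.M0 × S.M1 × Bool) :
    IsProbabilityMeasure (belief φ (t + 1) (nextHist φ t h p)) ∧
      MemLp id 2 (belief φ (t + 1) (nextHist φ t h p)) := by
  have := isProbabilityMeasure_belief hφ ht h
  rw [lintegral_stepLaw_stageCost hφ ht h] at hc
  rw [nextHist, belief_extend]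
  exact ⟨isProbabilityMeasure_update _ _ _ (hφ.prs_apply ht h) _ _ _ _,
    memLp_update ht hθ _ (hφ.prs_apply ht h) _ _ _ hc _⟩

/-- The value function bounds the cost-to-go of every measurable strategy from below. -/
theorem SolvesDP.le_costToGo {V : S.ValueFn} (hV : S.SolvesDP V) {φ : S.Strategy}
    (hφ : φ.IsMeasurable) {n t : ℕ} (hn : t + n = S.T + 1) (h : S.Hist t) (θ : S.Belief)
    (hθ : θ.1 = belief φ t h) :
    ENNReal.ofReal (V t h.x0 h.m0 θ h.zt) ≤ costToGo φ n t h := by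
  induction n generalizing t θ with
  | zero =>
    obtain rfl : t = S.T + 1 := by omega
    simp [hV.terminal]
  | succ n ih =>
    have ht : t ≤ S.T := by omega
    -- If the expected stage cost is infinite, so is the cost-to-go. Otherwise every next belief has
    -- finite second moment and the induction hypothesis applies to it.
    by_cases hc : ∫⁻ p, ENNReal.ofReal (stageCost φ t h p.1 p.2.1)
      ∂(S.stepLaw t (belief φ t h) h.zt) = ⊤
    · rw [costToGo_succ hφ n ht, ← lintegral_stepLaw_stageCost hφ ht h, hc, top_add]
      exact le_top
    · have hle := (hV.step t ht h.x0 h.m0 θ h.zt).2 ⟨φ.act t h, φ.prs t h, hφ.prs_apply ht h, rfl⟩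
      rw [dpObjective_strategy ht (hV.nonneg (n := n) (by omega)) φ h θ hθ,
        ← max_eq_left (hV.nonneg hn h.x0 h.m0 θ h.zt), ← EReal.coe_ennreal_ofReal,
        EReal.coe_ennreal_le_coe_ennreal_iff] at hle
      refine hle.trans (lintegral_mono fun p => ?_)
      have hmem := belief_nextHist_mem hφ ht (hθ ▸ θ.2.2) hc p
      refine add_le_add le_rfl ?_
      refine (toENNReal_extendTop hmem).trans_le ?_
      exact ih (by omega) (nextHist φ t h p) ⟨_, hmem⟩ rfl

/-- A strategy that attains the minima of the dynamic program has a cost-to-go bounded by the value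
function. -/
theorem SolvesDP.costToGo_le {V : S.ValueFn} (hV : S.SolvesDP V) {φ : S.Strategy}
    (hφ : φ.IsMeasurable) (hmin : S.AttainsDP V φ) {n t : ℕ} (hn : t + n = S.T + 1) (h : S.Hist t)
    (θ : S.Belief) (hθ : θ.1 = belief φ t h) :
    costToGo φ n t h ≤ ENNReal.ofReal (V t h.x0 h.m0 θ h.zt) := by
  induction n generalizing t θ with
  | zero => simp [costToGo]
  | succ n ih =>
    have ht : t ≤ S.T := by omega
    have heq := hmin t ht h θ hθ
    rw [dpObjective_strategy ht (hV.nonneg (n := n) (by omega)) φ h θ hθ,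
      ← max_eq_left (hV.nonneg hn h.x0 h.m0 θ h.zt), ← EReal.coe_ennreal_ofReal,
      EReal.coe_ennreal_eq_coe_ennreal_iff] at heq
    -- The value is a real number, so attaining it forces a finite expected stage cost.
    have hc : ∫⁻ p, ENNReal.ofReal (stageCost φ t h p.1 p.2.1)
        ∂(S.stepLaw t (belief φ t h) h.zt) ≠ ⊤ :=
      ((lintegral_mono fun p => le_self_add).trans_lt
        (heq ▸ ENNReal.ofReal_lt_top)).ne
    rw [← heq]
    refine lintegral_mono fun p => ?_
    have hmem := belief_nextHist_mem hφ ht (hθ ▸ θ.2.2) hc p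
    refine add_le_add le_rfl ?_
    refine le_trans ?_ (toENNReal_extendTop hmem).ge
    exact ih (by omega) (nextHist φ t h p) ⟨_, hmem⟩ rfl

theorem belief_zero_mem (φ : S.Strategy) (h : S.Hist 0) :
    IsProbabilityMeasure (belief φ 0 h) ∧ MemLp id 2 (belief φ 0 h) := by
  rw [belief]
  split
  · exact ⟨inferInstance, memLp_id_dirac _⟩
  · exact ⟨inferInstance, S.lawX1_memLp⟩

variable {Ω : Type*} [mΩ : MeasurableSpace Ω] {P : Measure Ω} [IsProbabilityMeasure P]
  (N : S.Noise P)

theorem SolvesDP.isOptimal {V : S.ValueFn} (hV : S.SolvesDP V) {φ : S.Strategy}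
    (hφ : Feasible N φ) (hmin : S.AttainsDP V φ) : IsOptimal N φ := by
  refine ⟨hφ, fun φ' hφ' => ?_⟩
  rw [← ENNReal.ofReal_le_ofReal_iff (totalCost_nonneg N φ'), ofReal_totalCost N hφ,
    ofReal_totalCost N hφ']
  refine lintegral_mono fun ω => ?_
  -- The two bounds chain because the history and belief at time 0 are definitionally the same under
  -- both strategies.
  exact (hV.costToGo_le hφ.isMeasurable hmin (by omega) (hist N φ 0 ω)
      ⟨_, belief_zero_mem φ (hist N φ 0 ω)⟩ rfl).trans
    (hV.le_costToGo hφ'.isMeasurable (by omega) (hist N φ' 0 ω) ⟨_, belief_zero_mem φ _⟩ rfl)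

/-- The belief is a version of the conditional law of the local state given the common
information. -/
theorem condExp_state1 {φ : S.Strategy} (hφ : φ.IsMeasurable) {t : ℕ} (ht : t ≤ S.T)
    {E : Set S.X1} (hE : MeasurableSet E) :
    P⟦state1 N φ t ⁻¹' E | MeasurableSpace.comap (hist N φ t) inferInstance⟧ =ᵐ[P]
      fun ω => (belief φ t (hist N φ t ω)).real E := by
  have hh := measurable_hist N hφ ht
  have hs := measurable_state1 N hφ ht
  have hb : Measurable fun h => belief φ t h E :=
    (Measure.measurable_coe hE).comp (measurable_belief hφ ht)
  have hp := isProbabilityMeasure_belief hφ ht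
  have hreal : Integrable (fun ω => (belief φ t (hist N φ t ω)).real E) P :=
    Integrable.of_bound (hb.comp hh).ennreal_toReal.aestronglyMeasurable 1
      (ae_of_all _ fun ω => by
        rw [Real.norm_of_nonneg measureReal_nonneg]
        exact measureReal_le_one)
  -- Sets of the conditioning σ-algebra are preimages of some `A` under the history; on each, the
  -- required identity is the disintegration tested on the product of the indicators of `A` and `E`.
  refine (ae_eq_condExp_of_forall_setIntegral_eq hh.comap_le
    ((integrable_const 1).indicator (hs hE)) (fun _ _ _ => hreal.integrableOn) ?_ ?_).symm
  · rintro _ ⟨A, hA, rfl⟩ -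
    have hAm : MeasurableSet (hist N φ t ⁻¹' A) := hh hA
    have hf : Measurable fun q : S.Hist t × S.X1 × S.M1 =>
        A.indicator (1 : S.Hist t → ℝ≥0∞) q.1 * E.indicator (1 : S.X1 → ℝ≥0∞) q.2.1 :=
      ((measurable_one.indicator hA).comp measurable_fst).mul
        ((measurable_one.indicator hE).comp measurable_snd.fst)
    have key := lintegral_belief N hφ ht hf
    have hL : ∫⁻ ω, A.indicator (1 : S.Hist t → ℝ≥0∞) (hist N φ t ω) *
        E.indicator (1 : S.X1 → ℝ≥0∞) (state1 N φ t ω) ∂P =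
        P (state1 N φ t ⁻¹' E ∩ hist N φ t ⁻¹' A) := by
      rw [← lintegral_indicator_one ((hs hE).inter hAm)]
      refine lintegral_congr fun ω => ?_
      by_cases h1 : hist N φ t ω ∈ A <;> by_cases h2 : state1 N φ t ω ∈ E <;> simp [h1, h2]
    have hR : ∀ h, ∫⁻ x, ∫⁻ _, A.indicator (1 : S.Hist t → ℝ≥0∞) h *
        E.indicator (1 : S.X1 → ℝ≥0∞) x ∂(S.modeLaw h.zt) ∂(belief φ t h) =
        A.indicator (fun h => belief φ t h E) h := by
      intro h
      by_cases h1 : h ∈ A <;> simp [h1, lintegral_indicator_one hE]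
    simp only [hL, hR] at key
    have hset : ∫⁻ ω, A.indicator (fun h => belief φ t h E) (hist N φ t ω) ∂P =
        ∫⁻ ω in hist N φ t ⁻¹' A, belief φ t (hist N φ t ω) E ∂P := by
      rw [← lintegral_indicator hAm]
      rfl
    rw [hset] at key
    simp only [measureReal_def]
    have hbh : Measurable fun ω => belief φ t (hist N φ t ω) E := hb.comp hh
    rw [integral_toReal hbh.aemeasurable (ae_of_all _ fun ω => measure_lt_top _ _), ← key,
      integral_indicator (hs hE)]
    simp [measureReal_def, Measure.restrict_apply (hs hE)]
  · exact (hb.ennreal_toReal.comp (comap_measurable _)).aestronglyMeasurable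

end SwitchedSystem

end

end NCS

theorem theorem1 (S : NCS.SwitchedSystem) {Ω : Type*} [MeasurableSpace Ω]
    (P : Measure Ω) [IsProbabilityMeasure P] (N : S.Noise P)
    (V : S.ValueFn) (hV : S.SolvesDP V)
    (φ : S.Strategy) (hφ : NCS.SwitchedSystem.Feasible N φ) (hmin : S.AttainsDP V φ) :
    NCS.SwitchedSystem.IsOptimal N φ ∧
      ∀ φ' : S.Strategy, NCS.SwitchedSystem.Feasible N φ' →
        ∀ t ≤ S.T, ∀ E : Set S.X1, MeasurableSet E →
          P⟦NCS.SwitchedSystem.state1 N φ' t ⁻¹' E |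
              MeasurableSpace.comap (NCS.SwitchedSystem.hist N φ' t) inferInstance⟧ =ᵐ[P]
            fun ω => (NCS.SwitchedSystem.belief φ' t (NCS.SwitchedSystem.hist N φ' t ω)).real E :=
  ⟨hV.isOptimal N hφ hmin,
    fun _ hφ' _ ht _ hE => NCS.SwitchedSystem.condExp_state1 N hφ'.isMeasurable ht hE⟩
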